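/- An election $E=(C,V)$ consists of a finite set $C$ of candidates and a finite set $V$ of voters, each voter $v\in V$ having a ranking (strict total order) $\succ_v$ of $C$. For $C'\subseteq C$ and $V'\subseteq V$, the subelection $(C',V')$ of $E$ is the election in which each $v\in V'$ ranks the candidates in $C'$ in the same way as in $E$; it is an identity subelection if all voters in $V'$ have the same ranking of $C'$. The decision problem Hidden-ID is: given an election $E=(C,V)$ (presented by the list of its candidates and the rankings of its voters) and $m',n'\in\mathbb{N}$ (written in binary), is there an identity subelection $(C',V')$ of $E$ with $|C'|\ge m'$ and $|V'|\ge n'$? **Corollary.** Hidden-ID is in FPT for the parameterization by the number $|V|$ of voters, and in XP for the parameterization by the number $n'$ of voters in the solution. That is, writing $|x|$ for the length of the encoding of an instance $x=(E,m',n')$: there are a computable function $f:\mathbb{N}\to\mathbb{N}$, a polynomial $p$ and a (multi-stack) Turing machine that decides every instance $x$ of Hidden-ID in at most $f(|V|)\cdot p(|x|)$ steps; and there are a computable function $g:\mathbb{N}\to\mathbb{N}$ and a (multi-stack) Turing machine that decides every instance $x$ of Hidden-ID in at most $|x|^{g(n')}+g(n')$ steps. -/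

import Mathlib

/-! ### Elections, subelections, identity -/

/-- An (ordinal) election with candidate set `C` and voter set `V`:
every voter `v` has a ranking `≻_v` of the candidates, i.e. a strict total order on `C`;
`pref v c d` reads `c ≻_v d`. Distinct voters may have the same ranking. -/
structure Election (C V : Type) where
  pref : V → C → C → Prop
  strictTotal : ∀ v, IsStrictTotalOrder C (pref v)

namespace Election

/-- The subelection `(C', V')` of `E`: the voters in `V'` rank the candidates in `C'` as in `E`. -/
def subelection {C V : Type} (E : Election C V) (C' : Finset C) (V' : Finset V) :
    Election {c // c ∈ C'} {v // v ∈ V'} where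
  pref v c d := E.pref v c d
  strictTotal v :=
    haveI := E.strictTotal v
    { trichotomous := fun _ _ hcd hdc => Subtype.ext
        (Std.Trichotomous.trichotomous (r := E.pref v) _ _ hcd hdc)
      irrefl := fun c => irrefl_of (E.pref v) (c : C)
      trans := fun _ _ _ hab hbc => trans_of (E.pref v) hab hbc }

/-- An identity election: all voters have the same ranking. -/
def IsIdentity {C V : Type} (E : Election C V) : Prop :=
  ∀ v w : V, E.pref v = E.pref w

open Classical in
/-- The ranking of the voter `v` written as a list, from the most to the least preferred
candidate. -/
noncomputable def ballot {m : ℕ} {V : Type} (E : Election (Fin m) V) (v : V) : List (Fin m) :=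
  (List.finRange m).insertionSort (fun c d => ¬ E.pref v d c)

theorem ballot_perm {m : ℕ} {V : Type} (E : Election (Fin m) V) (v : V) :
    (E.ballot v).Perm (List.finRange m) := by
  classical
  exact List.perm_insertionSort _ _

theorem ballot_pairwise {m : ℕ} {V : Type} (E : Election (Fin m) V) (v : V) :
    (E.ballot v).Pairwise (E.pref v) := by
  classical
  have := E.strictTotal v
  have : Std.Total (fun c d => ¬ E.pref v d c) :=
    ⟨fun a b => by
      by_contra h
      push Not at h
      exact asymm_of (E.pref v) h.1 h.2⟩
  have : IsTrans (Fin m) (fun c d => ¬ E.pref v d c) :=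
    ⟨fun a b c hab hbc hca => by
      rcases trichotomous_of (E.pref v) b c with h | h | h
      · exact hab (trans_of (E.pref v) h hca)
      · exact hab (h ▸ hca)
      · exact hbc h⟩
  have hs : (E.ballot v).Pairwise (fun c d => ¬ E.pref v d c) := List.pairwise_insertionSort _ _
  have hn : (E.ballot v).Nodup := (E.ballot_perm v).nodup_iff.2 (List.nodup_finRange m)
  refine (hs.and hn).imp ?_
  rintro a b ⟨h1, h2⟩
  rcases trichotomous_of (E.pref v) a b with h | h | h
  · exact h
  · exact absurd h h2
  · exact absurd h h1

end Election

/-! ### The decision problem Hidden-ID and its encoding -/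

/-- An input of Hidden-ID: an election, whose candidates and voters are numbered, together with
the required number `m'` of candidates and the required number `n'` of voters. -/
structure HiddenIDInstance where
  numCandidates : ℕ
  numVoters : ℕ
  election : Election (Fin numCandidates) (Fin numVoters)
  m' : ℕ
  n' : ℕ

/-- The question of Hidden-ID: is there an identity subelection `(C', V')`
with `|C'| ≥ m'` and `|V'| ≥ n'`? -/
def HiddenID (I : HiddenIDInstance) : Prop :=
  ∃ (C' : Finset (Fin I.numCandidates)) (V' : Finset (Fin I.numVoters)),
    I.m' ≤ C'.card ∧ I.n' ≤ V'.card ∧ (I.election.subelection C' V').IsIdentity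

/-- The input alphabet: binary digits, a mark that ends a number, a mark that ends a list. -/
inductive InputSymbol where
  | bit (b : Bool)
  | endNumber
  | endList
  deriving DecidableEq, Fintype

/-- A natural number in binary. -/
def encodeNumber (k : ℕ) : List InputSymbol :=
  (Computability.encodeNat k).map InputSymbol.bit ++ [InputSymbol.endNumber]

/-- A list of (numbered) candidates. -/
def encodeCandidates {m : ℕ} (l : List (Fin m)) : List InputSymbol :=
  l.flatMap (fun c => encodeNumber c) ++ [InputSymbol.endList]

/-- The encoding of an instance: the numbers `m'` and `n'` in binary, the list of all candidates,
and then, voter by voter, the ranking of that voter. -/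
noncomputable def encodeInstance (I : HiddenIDInstance) : List InputSymbol :=
  encodeNumber I.m' ++ encodeNumber I.n' ++
    encodeCandidates (List.finRange I.numCandidates) ++
    (List.finRange I.numVoters).flatMap (fun v => encodeCandidates (I.election.ballot v))

/-! ### Parameterized complexity classes -/

open Classical in
/-- The decision problem `Q`, with instances encoded by `enc`, is decided by a multi-stack Turing
machine that, on every instance `x`, halts after at most `T x` steps. -/
def DecidableInTime {α Γ : Type} (enc : α → List Γ) (Q : α → Prop) (T : α → ℕ) : Prop :=
  ∃ M : Turing.TM2ComputableAux Γ Bool, ∀ x : α,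
    Nonempty (Turing.TM2OutputsInTime M.tm
      ((enc x).map M.inputAlphabet.symm)
      (some ((Computability.encodeBool (decide (Q x))).map M.outputAlphabet.symm))
      (T x))

/-- `Q` with parameter `κ` is in FPT: it is decided in time `f (κ x) * p |x|` for a computable
function `f` and a polynomial `p`, where `|x|` is the length of the encoding of `x`. -/
def InFPT {α Γ : Type} (enc : α → List Γ) (Q : α → Prop) (κ : α → ℕ) : Prop :=
  ∃ (f : ℕ → ℕ) (p : Polynomial ℕ), Computable f ∧
    DecidableInTime enc Q (fun x => f (κ x) * p.eval (enc x).length)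

/-- `Q` with parameter `κ` is in (uniform) XP: it is decided in time `|x| ^ f (κ x) + f (κ x)`
for a computable function `f`. -/
def InXP {α Γ : Type} (enc : α → List Γ) (Q : α → Prop) (κ : α → ℕ) : Prop :=
  ∃ f : ℕ → ℕ, Computable f ∧
    DecidableInTime enc Q (fun x => (enc x).length ^ f (κ x) + f (κ x))

/-! For a set `V'` of voters let `d` dominate `c` when every voter in `V'` prefers `d` to `c`. If
`V'` is nonempty, this is a strict partial order, and the sets of candidates on which `V'` agrees
are exactly its chains. Voters can be discarded from an identity subelection, so Hidden-ID asks
whether some `V'` of size exactly `n'` has a dominance chain of `m'` candidates. For a fixed `V'`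
this is decided by levels: the first level consists of all candidates, each further level of the
candidates dominated by a member of the level before it, and a chain of `m'` candidates exists iff
the first `m'` levels are nonempty (`Election.levelsNonempty_iff`). If `V'` is empty, dominance
holds between any two candidates and chains may repeat, so `m' ≤ |C|` has to be demanded separately;
`hiddenID_iff` is the resulting criterion.

One machine serves both claims. It tries all selections of `n'` voters and spends polynomial time on
each (`hiddenID_decidableInTime`). The number of selections is at most `2 ^ |V|`, which gives FPT,
and at most `|V| ^ n'`, which gives XP.

The machine is written as a structured stack program. Such programs compile to Turing machines
without any loss in the number of steps (`StackProg.stepN_code`,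
`StackProg.decidableInTime_of_run`), so only runs of programs have to be analysed. Two points need
care. The numbers `m'` and `n'` are binary and may be exponential in the input length; they are
decremented once per candidate or voter read, which yields unary copies capped at `|C|` and `|V|`,
and a nonzero remainder means rejection. The selections are enumerated in place by a successor
operation on bit words (`isChain_selections`, `StackProg.nextProg_takes`). -/

/-! ### A structured programming language for stack machines -/

/-- Elementary operations on stacks; `move` and `copy` do nothing if the source is empty. -/
inductive StackOp (K A : Type) where
  | push (y : K) (a : A)
  | move (x y : K)
  | copy (x y : K)
  | drop (x : K)

/-- Structured programs over the stacks `K` with alphabet `A`. A condition may depend on the top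
symbols of all stacks. -/
inductive StackProg (K A : Type) where
  | act (l : List (StackOp K A))
  | seq (p q : StackProg K A)
  | ite (c : (K → Option A) → Bool) (p q : StackProg K A)
  | while (c : (K → Option A) → Bool) (p : StackProg K A)

section Language

variable {K A : Type} [DecidableEq K]

/-- The effect of an elementary operation on the stacks. -/
def StackOp.run : StackOp K A → (K → List A) → K → List A
  | .push y a, s => Function.update s y (a :: s y)
  | .move x y, s =>
    match s x with
    | [] => s
    | a :: l => Function.update (Function.update s x l) y (a :: Function.update s x l y)
  | .copy x y, s =>
    match s x with
    | [] => s
    | a :: _ => Function.update s y (a :: s y)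
  | .drop x, s => Function.update s x (s x).tail

/-- The effect of a list of elementary operations. -/
def StackOp.runAll : List (StackOp K A) → (K → List A) → K → List A
  | [], s => s
  | o :: l, s => runAll l (o.run s)

/-- The top symbols of the stacks. -/
def stackTops (s : K → List A) : K → Option A := fun k => (s k).head?

namespace StackProg

/-- `Run p s n s'`: started with stacks `s`, the program `p` ends with stacks `s'`
after `n` steps. -/
inductive Run : StackProg K A → (K → List A) → ℕ → (K → List A) → Prop
  | act (l s) : Run (.act l) s 1 (StackOp.runAll l s)
  | seq {p q s a s₁ b s₂} : Run p s a s₁ → Run q s₁ b s₂ → Run (.seq p q) s (a + b) s₂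
  | ite_true {c p q s a s'} : c (stackTops s) = true → Run p s a s' → Run (.ite c p q) s (a + 1) s'
  | ite_false {c p q s a s'} : c (stackTops s) = false → Run q s a s' →
      Run (.ite c p q) s (a + 1) s'
  | while_true {c p s a s₁ b s₂} : c (stackTops s) = true → Run p s a s₁ →
      Run (.while c p) s₁ b s₂ → Run (.while c p) s (a + b + 1) s₂
  | while_false {c p s} : c (stackTops s) = false → Run (.while c p) s 1 s

/-! ### Compilation of programs to machine code -/

/-- The labels of the machine code of a program. -/
def Label : StackProg K A → Type
  | .act _ => Unit
  | .seq p q => Label p ⊕ Label q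
  | .ite _ p q => Option (Label p ⊕ Label q)
  | .while _ p => Option (Label p)

/-- The label at which a program starts. -/
def entry : (p : StackProg K A) → p.Label
  | .act _ => ()
  | .seq p _ => Sum.inl p.entry
  | .ite _ _ _ => none
  | .while _ _ => none

/-- There are finitely many labels. -/
@[reducible] def labelFintype : (p : StackProg K A) → Fintype p.Label
  | .act _ => inferInstanceAs (Fintype Unit)
  | .seq p q =>
    haveI := p.labelFintype
    haveI := q.labelFintype
    inferInstanceAs (Fintype (p.Label ⊕ q.Label))
  | .ite _ p q =>
    haveI := p.labelFintype
    haveI := q.labelFintype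
    inferInstanceAs (Fintype (Option (p.Label ⊕ q.Label)))
  | .while _ p =>
    haveI := p.labelFintype
    inferInstanceAs (Fintype (Option p.Label))

/-- The stack alphabets of the machine: an extra stack `none` holds the output. -/
abbrev MachineAlphabet (K A : Type) : Option K → Type
  | none => Bool
  | some _ => A

/-- Stacks of the program as stacks of the machine, with an empty output. -/
def machineStacks (s : K → List A) : (k : Option K) → List (MachineAlphabet K A k)
  | none => []
  | some k => s k

/-- The statements of the machine. Its internal state remembers a symbol for every stack. -/
abbrev MachineStmt (K A Λ : Type) := Turing.TM2.Stmt (MachineAlphabet K A) Λ (K → Option A)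

variable {Λ : Type}

theorem machineStacks_update (s : K → List A) (k : K) (l : List A) :
    Function.update (machineStacks s) (some k) l = machineStacks (Function.update s k l) := by
  funext j
  cases j with
  | none => rfl
  | some j =>
    by_cases h : j = k
    · subst h; simp [machineStacks]
    · simp [machineStacks, h]

/-- The machine code that loads the top symbols of the given stacks. -/
def peekCode : List K → MachineStmt K A Λ → MachineStmt K A Λ
  | [], q => q
  | k :: l, q => .peek (some k) (fun v a => Function.update v k a) (peekCode l q)

theorem stepAux_peekCode (l : List K) (q : MachineStmt K A Λ) (v : K → Option A)
    (s : K → List A) : Turing.TM2.stepAux (peekCode l q) v (machineStacks s) =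
      Turing.TM2.stepAux q (fun k => if k ∈ l then stackTops s k else v k) (machineStacks s) := by
  induction l generalizing v with
  | nil => simp [peekCode]
  | cons o l ih =>
    have e : Turing.TM2.stepAux (peekCode (o :: l) q) v (machineStacks s) =
      Turing.TM2.stepAux (peekCode l q) (Function.update v o (s o).head?) (machineStacks s) := rfl
    rw [e, ih]
    congr 1
    funext k
    by_cases h : k = o
    · subst h; simp [stackTops]
    · simp [h]

/-- The machine code that evaluates a condition. -/
noncomputable def testCode [Fintype K] (c : (K → Option A) → Bool) (q r : MachineStmt K A Λ) :
    MachineStmt K A Λ :=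
  peekCode Finset.univ.toList (.branch c q r)

/-- Every stack is peeked, so each entry of the internal state is overwritten and the earlier state
`v` has no influence. -/
theorem stepAux_testCode [Fintype K] (c : (K → Option A) → Bool) (q r : MachineStmt K A Λ)
    (v : K → Option A) (s : K → List A) :
    Turing.TM2.stepAux (testCode c q r) v (machineStacks s) =
      Turing.TM2.stepAux (if c (stackTops s) then q else r) (stackTops s) (machineStacks s) := by
  rw [testCode, stepAux_peekCode]
  simp only [Finset.mem_toList, Finset.mem_univ, if_true, Turing.TM2.stepAux]
  cases c (stackTops s) <;> rfl

variable [Inhabited A]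

/-- The machine code of an elementary operation, followed by `q`. -/
def opCode (o : StackOp K A) (q : MachineStmt K A Λ) : MachineStmt K A Λ :=
  match o with
  | .push y a => .push (some y) (fun _ => a) q
  | .move x y => .pop (some x) (fun v a => Function.update v x a)
      (.branch (fun v => (v x).isSome) (.push (some y) (fun v => ((v x).getD default : A)) q) q)
  | .copy x y => .peek (some x) (fun v a => Function.update v x a)
      (.branch (fun v => (v x).isSome) (.push (some y) (fun v => ((v x).getD default : A)) q) q)
  | .drop x => .pop (some x) (fun v _ => v) q

/-- The resulting state may stay unspecified: a later test or operation reloads whatever part of the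
state it uses. -/
theorem stepAux_opCode (o : StackOp K A) (q : MachineStmt K A Λ) (v : K → Option A)
    (s : K → List A) : ∃ v', Turing.TM2.stepAux (opCode o q) v (machineStacks s) =
      Turing.TM2.stepAux q v' (machineStacks (o.run s)) := by
  cases o with
  | push y a =>
    refine ⟨v, ?_⟩
    rw [StackOp.run, ← machineStacks_update]
    rfl
  | move x y =>
    cases h : s x with
    | nil =>
      refine ⟨Function.update v x none, ?_⟩
      simp [opCode, StackOp.run, h, machineStacks_update, machineStacks]
      rw [← h, Function.update_eq_self]
    | cons a l =>
      refine ⟨Function.update v x (some a), ?_⟩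
      simp [opCode, StackOp.run, h, machineStacks_update, machineStacks]
  | copy x y =>
    cases h : s x with
    | nil =>
      refine ⟨Function.update v x none, ?_⟩
      simp [opCode, StackOp.run, h, machineStacks]
    | cons a l =>
      refine ⟨Function.update v x (some a), ?_⟩
      simp [opCode, StackOp.run, h, machineStacks_update, machineStacks]
  | drop x =>
    refine ⟨v, ?_⟩
    rw [StackOp.run, ← machineStacks_update]
    rfl

theorem stepAux_opCodes (l : List (StackOp K A)) (q : MachineStmt K A Λ) (v : K → Option A)
    (s : K → List A) : ∃ v', Turing.TM2.stepAux (l.foldr opCode q) v (machineStacks s) =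
      Turing.TM2.stepAux q v' (machineStacks (StackOp.runAll l s)) := by
  induction l generalizing v s with
  | nil => exact ⟨v, rfl⟩
  | cons o l ih =>
    obtain ⟨v₁, h₁⟩ := stepAux_opCode o (l.foldr opCode q) v s
    obtain ⟨v₂, h₂⟩ := ih v₁ (o.run s)
    exact ⟨v₂, h₁.trans h₂⟩

variable [Fintype K]

/-- The machine code of a program, with its labels embedded by `e` and followed by `k`. -/
noncomputable def code : (p : StackProg K A) → (e : p.Label → Λ) → (k : MachineStmt K A Λ) →
    p.Label → MachineStmt K A Λ
  | .act l, _, k => fun _ => l.foldr opCode k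
  | .seq p q, e, k => Sum.elim
      (p.code (fun l => e (Sum.inl l)) (.goto fun _ => e (Sum.inr q.entry)))
      (q.code (fun l => e (Sum.inr l)) k)
  | .ite c p q, e, k => fun l =>
      match l with
      | none => testCode c (.goto fun _ => e (some (Sum.inl p.entry)))
          (.goto fun _ => e (some (Sum.inr q.entry)))
      | some (Sum.inl l) => p.code (fun l => e (some (Sum.inl l))) k l
      | some (Sum.inr l) => q.code (fun l => e (some (Sum.inr l))) k l
  | .while c p, e, k => fun l =>
      match l with
      | none => testCode c (.goto fun _ => e (some p.entry)) k
      | some l => p.code (fun l => e (some l)) (.goto fun _ => e none) l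

/-- The configuration reached after `n` steps. -/
def stepN (M : Λ → MachineStmt K A Λ) (n : ℕ)
    (x : Option (Turing.TM2.Cfg (MachineAlphabet K A) Λ (K → Option A))) :=
  (flip bind (Turing.TM2.step M))^[n] x

/-- The step counts agree exactly, because one machine step executes a whole statement up to its
jump. The continuation `k` is thus executed within the last step of `p`. Keeping `e` and `k` general
lets the induction pass to subprograms, whose code sits under other labels and ends in other jumps.
-/
theorem stepN_code (M : Λ → MachineStmt K A Λ) {p : StackProg K A} {s s' : K → List A} {n : ℕ}
    (h : Run p s n s') : ∀ (e : p.Label → Λ) (k : MachineStmt K A Λ),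
    (∀ l, M (e l) = p.code e k l) → ∀ v, ∃ v',
    stepN M n (some ⟨some (e p.entry), v, machineStacks s⟩) =
      some (Turing.TM2.stepAux k v' (machineStacks s')) := by
  induction h with
  | act l s =>
    intro e k hM v
    obtain ⟨v', hv⟩ := stepAux_opCodes l k v s
    refine ⟨v', ?_⟩
    rw [← hv]
    exact congrArg (fun q => some (Turing.TM2.stepAux q v (machineStacks s))) (hM ())
  | @seq p q s a s₁ b s₂ _ _ ih₁ ih₂ =>
    intro e k hM v
    obtain ⟨v₁, h₁⟩ := ih₁ (fun l => e (Sum.inl l)) (.goto fun _ => e (Sum.inr q.entry))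
      (fun l => hM (Sum.inl l)) v
    obtain ⟨v₂, h₂⟩ := ih₂ (fun l => e (Sum.inr l)) k (fun l => hM (Sum.inr l)) v₁
    refine ⟨v₂, ?_⟩
    rw [Nat.add_comm, stepN, Function.iterate_add_apply]
    exact (congrArg (stepN M b) h₁).trans h₂
  | @ite_true c p q s a s' hc _ ih =>
    intro e k hM v
    obtain ⟨v₁, h₁⟩ := ih (fun l => e (some (Sum.inl l))) k (fun l => hM (some (Sum.inl l)))
      (stackTops s)
    refine ⟨v₁, ?_⟩
    rw [← h₁, stepN, Function.iterate_succ_apply]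
    refine congrArg (stepN M a) ?_
    refine (congrArg (fun q => some (Turing.TM2.stepAux q v (machineStacks s))) (hM none)).trans ?_
    simp [code, stepAux_testCode, hc]
  | @ite_false c p q s a s' hc _ ih =>
    intro e k hM v
    obtain ⟨v₁, h₁⟩ := ih (fun l => e (some (Sum.inr l))) k (fun l => hM (some (Sum.inr l)))
      (stackTops s)
    refine ⟨v₁, ?_⟩
    rw [← h₁, stepN, Function.iterate_succ_apply]
    refine congrArg (stepN M a) ?_
    refine (congrArg (fun q => some (Turing.TM2.stepAux q v (machineStacks s))) (hM none)).trans ?_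
    simp [code, stepAux_testCode, hc]
  | @while_true c p s a s₁ b s₂ hc _ _ ih₁ ih₂ =>
    intro e k hM v
    obtain ⟨v₁, h₁⟩ := ih₁ (fun l => e (some l)) (.goto fun _ => e none)
      (fun l => hM (some l)) (stackTops s)
    obtain ⟨v₂, h₂⟩ := ih₂ e k hM v₁
    refine ⟨v₂, ?_⟩
    rw [← h₂, stepN, Function.iterate_succ_apply, Nat.add_comm, Function.iterate_add_apply]
    refine congrArg (stepN M b) (Eq.trans (congrArg (stepN M a) ?_) h₁)
    refine (congrArg (fun q => some (Turing.TM2.stepAux q v (machineStacks s))) (hM none)).trans ?_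
    simp [code, stepAux_testCode, hc]
  | @while_false c p s hc =>
    intro e k hM v
    refine ⟨stackTops s, ?_⟩
    refine (congrArg (fun q => some (Turing.TM2.stepAux q v (machineStacks s))) (hM none)).trans ?_
    simp [code, stepAux_testCode, hc]

end StackProg

end Language

/-! ### From programs to decision procedures -/

namespace StackProg

variable {K : Type} [DecidableEq K] [Fintype K]

/-- The machine code that outputs the bit on top of the stack `ans` and halts. -/
def outputCode {Λ : Type} (ans : K) : MachineStmt K InputSymbol Λ :=
  .pop (some ans) (fun v a => Function.update v ans a)
    (.push none (fun v => decide (v ans = some (.bit true)))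
      (.load (fun _ _ => none) .halt))

/-- The choice is immaterial: `opCode` uses the default only behind a test that a symbol is present.
-/
instance : Inhabited InputSymbol := ⟨.endList⟩

/-- The Turing machine that runs a program and outputs the bit on top of the stack `ans`. -/
noncomputable def machine (p : StackProg K InputSymbol) (inp ans : K) : Turing.FinTM2 :=
  haveI := p.labelFintype
  { K := Option K
    k₀ := some inp
    k₁ := none
    Γ := MachineAlphabet K InputSymbol
    Λ := p.Label
    main := p.entry
    σ := K → Option InputSymbol
    initialState := fun _ => none
    Γk₀Fin := inferInstanceAs (Fintype InputSymbol)
    m := p.code id (outputCode ans) }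

open Classical in
-- A machine with output must halt in exactly `haltList`: initial internal state and no stack but
-- the output occupied. Hence the program is required to empty every stack except `ans`, while
-- `outputCode` resets the state.
theorem decidableInTime_of_run {α : Type} {enc : α → List InputSymbol} {Q : α → Prop}
    {T : α → ℕ} (p : StackProg K InputSymbol) (inp ans : K)
    (h : ∀ x, ∃ n ≤ T x, Run p (Function.update (fun _ => []) inp (enc x)) n
      (Function.update (fun _ => []) ans [.bit (decide (Q x))])) :
    DecidableInTime enc Q T := by
  refine ⟨⟨machine p inp ans, Equiv.refl _, Equiv.refl _⟩, fun x => ?_⟩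
  obtain ⟨n, hn, hr⟩ := h x
  refine ⟨⟨⟨n, ?_⟩, hn⟩⟩
  obtain ⟨v', hv⟩ := stepN_code (p.code id (outputCode ans)) hr id (outputCode ans)
    (fun _ => rfl) (fun _ => none)
  have e₁ : Turing.initList (machine p inp ans) ((enc x).map (Equiv.refl InputSymbol).symm) =
      ⟨some p.entry, fun _ => none,
        machineStacks (Function.update (fun _ => []) inp (enc x))⟩ := by
    refine congrArg (Turing.TM2.Cfg.mk (some p.entry) fun _ => none) ?_
    funext k
    by_cases hk : k = some inp
    · subst hk
      simp [machine, machineStacks]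
      rfl
    · refine (dif_neg hk).trans ?_
      cases k with
      | none => rfl
      | some k =>
        exact (Function.update_of_ne (fun h => hk (congrArg some h)) (enc x) fun _ => []).symm
  have e₂ : Turing.haltList (machine p inp ans)
      ((Computability.encodeBool (decide (Q x))).map (Equiv.refl Bool).symm) =
      Turing.TM2.stepAux (outputCode (Λ := p.Label) ans) v' (machineStacks
        (Function.update (fun _ => []) ans [.bit (decide (Q x))])) := by
    refine congrArg (Turing.TM2.Cfg.mk none fun _ => none) ?_
    funext k
    cases k with
    | none =>
      simp [machine, machineStacks, Computability.encodeBool]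
      rfl
    | some k =>
      by_cases hk : k = ans
      · subst hk
        simp [machine, machineStacks]
      · simp [machine, machineStacks, hk]
  exact (congrArg (fun c => stepN (p.code id (outputCode ans)) n (some c)) e₁).trans
    (hv.trans (congrArg some e₂.symm))

end StackProg

local notation:max s:max "⟦" x " ↦ " l "⟧" => Function.update s x l

namespace StackProg

/-! ### Runs with an upper bound on the number of steps -/

section Takes

variable {K A : Type} [DecidableEq K]

/-- Started with stacks `s`, the program `p` ends with stacks `s'` after at most `t` steps. -/
def Takes (p : StackProg K A) (s s' : K → List A) (t : ℕ) : Prop := ∃ n ≤ t, Run p s n s'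

variable {p q : StackProg K A} {c : (K → Option A) → Bool} {s s₁ s₂ s' : K → List A} {a b t : ℕ}

theorem Takes.to (h : Takes p s s₁ a) (hs : s₁ = s') (ht : a ≤ t) : Takes p s s' t := by
  obtain ⟨n, hn, h⟩ := h
  exact ⟨n, hn.trans ht, hs ▸ h⟩

theorem Takes.act (l : List (StackOp K A)) (s : K → List A) :
    Takes (.act l) s (StackOp.runAll l s) 1 := ⟨1, le_rfl, .act l s⟩

theorem Takes.seq (h₁ : Takes p s s₁ a) (h₂ : Takes q s₁ s₂ b) :
    Takes (.seq p q) s s₂ (a + b) := by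
  obtain ⟨n, hn, h₁⟩ := h₁
  obtain ⟨m, hm, h₂⟩ := h₂
  exact ⟨n + m, add_le_add hn hm, .seq h₁ h₂⟩

theorem Takes.ite_true (hc : c (stackTops s) = true) (h : Takes p s s' a) :
    Takes (.ite c p q) s s' (a + 1) := by
  obtain ⟨n, hn, h⟩ := h
  exact ⟨n + 1, by omega, .ite_true hc h⟩

theorem Takes.ite_false (hc : c (stackTops s) = false) (h : Takes q s s' a) :
    Takes (.ite c p q) s s' (a + 1) := by
  obtain ⟨n, hn, h⟩ := h
  exact ⟨n + 1, by omega, .ite_false hc h⟩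

theorem Takes.while_true (hc : c (stackTops s) = true) (h₁ : Takes p s s₁ a)
    (h₂ : Takes (.while c p) s₁ s₂ b) : Takes (.while c p) s s₂ (a + b + 1) := by
  obtain ⟨n, hn, h₁⟩ := h₁
  obtain ⟨m, hm, h₂⟩ := h₂
  exact ⟨n + m + 1, by omega, .while_true hc h₁ h₂⟩

theorem Takes.while_false (hc : c (stackTops s) = false) : Takes (.while c p) s s 1 :=
  ⟨1, le_rfl, .while_false hc⟩

end Takes

/-! ### Loops that move or erase symbols -/

section Loops

variable {K A : Type} [DecidableEq K]

/-- Moves symbols from `x` to `y` as long as they satisfy `c`. -/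
def moveWhile (c : A → Bool) (x y : K) : StackProg K A :=
  .while (fun t => (t x).any c) (.act [.move x y])

/-- Drops symbols from `x` as long as they satisfy `c`. -/
def dropWhile (c : A → Bool) (x : K) : StackProg K A :=
  .while (fun t => (t x).any c) (.act [.drop x])

/-- Moves symbols from `x` to `y` and `z` as long as they satisfy `c`. -/
def moveCopyWhile (c : A → Bool) (x y z : K) : StackProg K A :=
  .while (fun t => (t x).any c) (.act [.copy x z, .move x y])

/-- Moves all symbols from `x` to `y`. -/
def rewind (x y : K) : StackProg K A := moveWhile (fun _ => true) x y

/-- Empties `x`. -/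
def clear (x : K) : StackProg K A := dropWhile (fun _ => true) x

/-- The condition `hr` makes the loop stop precisely at the end of `u`. Each symbol costs a test and
a move, and one last test fails. -/
theorem moveWhile_takes {c : A → Bool} {x y : K} (hxy : x ≠ y) {r : List A}
    (hr : r.head?.any c = false) (u : List A) (hu : ∀ a ∈ u, c a = true) (s : K → List A)
    (hs : s x = u ++ r) :
    Takes (moveWhile c x y) s s⟦x ↦ r⟧⟦y ↦ u.reverse ++ s y⟧ (2 * u.length + 1) := by
  induction u generalizing s with
  | nil =>
    refine (Takes.while_false ?_).to ?_ (by simp)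
    · simpa [stackTops, hs] using hr
    · simp only [List.nil_append] at hs
      simp [← hs]
  | cons a u ih =>
    have hm : StackOp.runAll [.move x y] s = s⟦x ↦ u ++ r⟧⟦y ↦ a :: s y⟧ := by
      simp [StackOp.runAll, StackOp.run, hs, hxy.symm]
    refine (Takes.while_true ?_ (Takes.act _ s) (ih (fun b hb => hu b (by simp [hb])) _ ?_)).to ?_ ?_
    · simpa [stackTops, hs] using hu a (by simp)
    · simp [hm, hxy]
    · rw [hm]
      funext k
      simp only [Function.update_apply]
      split_ifs <;> simp_all
    · simp; omega

theorem dropWhile_takes {c : A → Bool} {x : K} {r : List A}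
    (hr : r.head?.any c = false) (u : List A) (hu : ∀ a ∈ u, c a = true) (s : K → List A)
    (hs : s x = u ++ r) :
    Takes (dropWhile c x) s s⟦x ↦ r⟧ (2 * u.length + 1) := by
  induction u generalizing s with
  | nil =>
    refine (Takes.while_false ?_).to ?_ (by simp)
    · simpa [stackTops, hs] using hr
    · simp only [List.nil_append] at hs
      simp [← hs]
  | cons a u ih =>
    have hm : StackOp.runAll [.drop x] s = s⟦x ↦ u ++ r⟧ := by
      simp [StackOp.runAll, StackOp.run, hs]
    refine (Takes.while_true ?_ (Takes.act _ s) (ih (fun b hb => hu b (by simp [hb])) _ ?_)).to ?_ ?_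
    · simpa [stackTops, hs] using hu a (by simp)
    · simp [hm]
    · simp [hm]
    · simp; omega

theorem moveCopyWhile_takes {c : A → Bool} {x y z : K} (hxy : x ≠ y) (hxz : x ≠ z) (hyz : y ≠ z)
    {r : List A} (hr : r.head?.any c = false) (u : List A) (hu : ∀ a ∈ u, c a = true)
    (s : K → List A) (hs : s x = u ++ r) :
    Takes (moveCopyWhile c x y z) s
      s⟦x ↦ r⟧⟦y ↦ u.reverse ++ s y⟧⟦z ↦ u.reverse ++ s z⟧ (2 * u.length + 1) := by
  induction u generalizing s with
  | nil =>
    refine (Takes.while_false ?_).to ?_ (by simp)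
    · simpa [stackTops, hs] using hr
    · simp only [List.nil_append] at hs
      simp [← hs]
  | cons a u ih =>
    have hm : StackOp.runAll [.copy x z, .move x y] s =
        s⟦x ↦ u ++ r⟧⟦y ↦ a :: s y⟧⟦z ↦ a :: s z⟧ := by
      simp only [StackOp.runAll, StackOp.run, hs]
      simp only [List.cons_append, Function.update_of_ne hxz, hs]
      funext k
      simp only [Function.update_apply]
      split_ifs <;> simp_all
    refine (Takes.while_true ?_ (Takes.act _ s) (ih (fun b hb => hu b (by simp [hb])) _ ?_)).to ?_ ?_
    · simpa [stackTops, hs] using hu a (by simp)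
    · simp [hm, hxy, hxz]
    · rw [hm]
      funext k
      simp only [Function.update_apply]
      split_ifs <;> simp_all
    · simp; omega

theorem rewind_takes {x y : K} (hxy : x ≠ y) (s : K → List A) :
    Takes (rewind x y) s s⟦x ↦ []⟧⟦y ↦ (s x).reverse ++ s y⟧ (2 * (s x).length + 1) :=
  moveWhile_takes hxy rfl (s x) (fun _ _ => rfl) s (by simp)

theorem clear_takes (x : K) (s : K → List A) :
    Takes (clear x) s s⟦x ↦ []⟧ (2 * (s x).length + 1) :=
  dropWhile_takes rfl (s x) (fun _ _ => rfl) s (by simp)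

/-- Empties all the given stacks. -/
def clearAll : List K → StackProg K A
  | [] => .act []
  | x :: l => .seq (clear x) (clearAll l)

theorem clearAll_takes (l : List K) (N : ℕ) (s : K → List A) (hs : ∀ x ∈ l, (s x).length ≤ N) :
    Takes (clearAll l) s (fun k => if k ∈ l then [] else s k) ((2 * N + 1) * l.length + 1) := by
  induction l generalizing s with
  | nil => exact (Takes.act [] s).to (by simp [StackOp.runAll]) (by simp)
  | cons x l ih =>
    refine ((clear_takes x s).seq (ih s⟦x ↦ []⟧ ?_)).to ?_ ?_
    · intro y hy
      by_cases h : y = x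
      · subst h; simp
      · simpa [h] using hs y (by simp [hy])
    · funext k
      by_cases h : k = x
      · subst h; simp
      · simp [h]
    · have := hs x (by simp)
      simp only [List.length_cons]
      nlinarith

end Loops

end StackProg

/-! ### Words and numbers on stacks -/

/-- The symbol is a binary digit. -/
def InputSymbol.isBit : InputSymbol → Bool
  | .bit _ => true
  | _ => false

theorem InputSymbol.isBit_of_mem_map {w : List Bool} {a : InputSymbol}
    (h : a ∈ w.map InputSymbol.bit) : a.isBit = true := by
  obtain ⟨b, _, rfl⟩ := List.mem_map.1 h
  rfl

/-- A binary word followed by its end mark. -/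
def encodeWord (w : List Bool) : List InputSymbol := w.map .bit ++ [.endNumber]

/-- A list of words, each followed by its end mark. -/
def encodeWords (l : List (List Bool)) : List InputSymbol := l.flatMap encodeWord

/-- A list of lists of words, each followed by its end mark. -/
def encodeTable (l : List (List (List Bool))) : List InputSymbol :=
  l.flatMap fun ws => encodeWords ws ++ [.endList]

/-- The value of a binary word, least significant digit first. -/
def wordValue : List Bool → ℕ
  | [] => 0
  | b :: w => b.toNat + 2 * wordValue w

/-- The word of length `n` that has the digit `1` in its first `v` places. -/
def unaryBits : ℕ → ℕ → List Bool
  | 0, _ => []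
  | n + 1, v => decide (0 < v) :: unaryBits n (v - 1)

theorem unaryBits_eq {n v : ℕ} (h : v ≤ n) :
    unaryBits n v = List.replicate v true ++ List.replicate (n - v) false := by
  induction n generalizing v with
  | zero => simp_all [unaryBits]
  | succ n ih =>
    cases v with
    | zero => simpa [unaryBits, List.replicate_succ] using ih (Nat.zero_le n)
    | succ v => simpa [unaryBits, List.replicate_succ] using ih (Nat.le_of_succ_le_succ h)

theorem length_unaryBits (n v : ℕ) : (unaryBits n v).length = n := by
  induction n generalizing v with
  | zero => rfl
  | succ n ih => simp [unaryBits, ih]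

/-- The two cases of a binary decrement, least significant digit first: the number is zero, or there
is a lowest digit `1` to borrow from. -/
theorem exists_leading_false (q : List Bool) :
    (∃ i, q = List.replicate i false) ∨ ∃ i r, q = List.replicate i false ++ true :: r := by
  induction q with
  | nil => exact Or.inl ⟨0, rfl⟩
  | cons b q ih =>
    cases b with
    | true => exact Or.inr ⟨0, q, rfl⟩
    | false =>
      rcases ih with ⟨i, rfl⟩ | ⟨i, r, rfl⟩
      · exact Or.inl ⟨i + 1, rfl⟩
      · exact Or.inr ⟨i + 1, r, rfl⟩

theorem wordValue_replicate_false (i : ℕ) : wordValue (List.replicate i false) = 0 := by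
  induction i with
  | zero => rfl
  | succ i ih => simp [List.replicate_succ, wordValue, ih]

theorem wordValue_borrow (i : ℕ) (r : List Bool) :
    wordValue (List.replicate i false ++ true :: r) =
      wordValue (List.replicate i true ++ false :: r) + 1 := by
  induction i with
  | zero => simp [wordValue, add_comm]
  | succ i ih => simp [List.replicate_succ, wordValue, ih]; ring

namespace StackProg

variable {K : Type} [DecidableEq K]

/-- Moves a word from `x` to `y`, reversing it. -/
def moveWord (x y : K) : StackProg K InputSymbol :=
  .seq (moveWhile InputSymbol.isBit x y) (.act [.move x y])

/-- Drops a word from `x`. -/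
def dropWord (x : K) : StackProg K InputSymbol :=
  .seq (dropWhile InputSymbol.isBit x) (.act [.drop x])

/-- Moves a word from `x` to `y`, reversing it, and puts a copy of it on `z`, by means of the empty
stack `t`. -/
def copyWord (x y t z : K) : StackProg K InputSymbol :=
  .seq (moveCopyWhile InputSymbol.isBit x y t)
    (.seq (.act [.move x y, .push z .endNumber]) (rewind t z))

theorem moveWord_takes {x y : K} (hxy : x ≠ y) (w : List Bool) (r : List InputSymbol)
    (s : K → List InputSymbol) (hs : s x = encodeWord w ++ r) :
    Takes (moveWord x y) s s⟦x ↦ r⟧⟦y ↦ (encodeWord w).reverse ++ s y⟧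
      (2 * (encodeWord w).length) := by
  refine ((moveWhile_takes hxy (r := .endNumber :: r) rfl (w.map .bit) ?_ s ?_).seq
    (Takes.act _ _)).to ?_ ?_
  · exact fun a => InputSymbol.isBit_of_mem_map
  · simp [hs, encodeWord]
  · simp only [StackOp.runAll, StackOp.run, Function.update_of_ne hxy, Function.update_self]
    funext k
    simp only [Function.update_apply]
    split_ifs <;> simp_all [encodeWord]
  · simp [encodeWord]; omega

theorem dropWord_takes (x : K) (w : List Bool) (r : List InputSymbol)
    (s : K → List InputSymbol) (hs : s x = encodeWord w ++ r) :
    Takes (dropWord x) s s⟦x ↦ r⟧ (2 * (encodeWord w).length) := by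
  refine ((dropWhile_takes (r := .endNumber :: r) rfl (w.map .bit) ?_ s ?_).seq
    (Takes.act _ _)).to ?_ ?_
  · exact fun a => InputSymbol.isBit_of_mem_map
  · simp [hs, encodeWord]
  · simp [StackOp.runAll, StackOp.run]
  · simp [encodeWord]; omega

theorem copyWord_takes {x y t z : K} (hd : [x, y, t, z].Nodup) (w : List Bool)
    (r : List InputSymbol) (s : K → List InputSymbol) (hs : s x = encodeWord w ++ r)
    (ht : s t = []) :
    Takes (copyWord x y t z) s
      s⟦x ↦ r⟧⟦y ↦ (encodeWord w).reverse ++ s y⟧⟦z ↦ encodeWord w ++ s z⟧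
      (4 * (encodeWord w).length) := by
  simp only [List.nodup_cons, List.mem_cons, not_or, List.not_mem_nil, not_false_eq_true,
    and_true, List.nodup_nil] at hd
  obtain ⟨⟨hxy, hxt, hxz⟩, ⟨hyt, hyz⟩, htz⟩ := hd
  refine ((moveCopyWhile_takes hxy hxt hyt (r := .endNumber :: r) rfl (w.map .bit) ?_ s ?_).seq
    ((Takes.act _ _).seq (rewind_takes htz _))).to ?_ ?_
  · exact fun a => InputSymbol.isBit_of_mem_map
  · simp [hs, encodeWord]
  · simp only [StackOp.runAll, StackOp.run, Function.update_of_ne hxy, Function.update_of_ne hxt,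
      Function.update_self]
    funext k
    simp only [Function.update_apply]
    split_ifs <;> simp_all [encodeWord]
  · simp only [StackOp.runAll, StackOp.run, Function.update_of_ne hxy, Function.update_of_ne hxt,
      Function.update_self, Function.update_of_ne htz,
      Function.update_of_ne (Ne.symm hyt), Function.update_of_ne (Ne.symm hxt)]
    simp [encodeWord, ht]; omega

/-- Decrements the number on `x` if it is positive, by means of the empty stack `t`, and pushes on
`y` whether it was positive. -/
def decrement (x t y : K) : StackProg K InputSymbol :=
  .seq (moveWhile (fun a => a = .bit false) x t)
    (.ite (fun h => h x = some (.bit true))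
      (.seq (.act [.drop x, .push x (.bit false)])
        (.seq (.while (fun h => (h t).isSome) (.act [.drop t, .push x (.bit true)]))
          (.act [.push y (.bit true)])))
      (.seq (rewind t x) (.act [.push y (.bit false)])))

/-- The symbols on `t` act only as a counter: the zeros skipped during a borrow come back as ones.
-/
theorem fill_takes {x t : K} (hxt : x ≠ t) (s : K → List InputSymbol) (u : List InputSymbol)
    (hu : s t = u) :
    Takes (.while (fun h => (h t).isSome) (.act [.drop t, .push x (.bit true)])) s
      s⟦t ↦ []⟧⟦x ↦ List.replicate u.length (.bit true) ++ s x⟧ (2 * u.length + 1) := by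
  induction u generalizing s with
  | nil =>
    refine (Takes.while_false ?_).to ?_ (by simp)
    · simp [stackTops, hu]
    · have h : s⟦t ↦ []⟧ = s := by rw [← hu, Function.update_eq_self]
      simp [h]
  | cons a u ih =>
    have hm : StackOp.runAll [.drop t, .push x (.bit true)] s =
        s⟦t ↦ u⟧⟦x ↦ .bit true :: s x⟧ := by
      simp [StackOp.runAll, StackOp.run, hu, hxt]
    refine (Takes.while_true ?_ (Takes.act _ s) (ih _ ?_)).to ?_ ?_
    · simp [stackTops, hu]
    · simp [hm, hxt.symm]
    · rw [hm]
      funext k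
      simp only [Function.update_apply]
      split_ifs <;> simp_all [List.replicate_succ']
    · simp; omega

/-- The width of the number is kept, so high zeros can appear and zero is not represented by the
empty word; length and value are all that later steps need. -/
theorem decrement_takes {x t y : K} (hd : [x, t, y].Nodup) (q : List Bool)
    (s : K → List InputSymbol) (hs : s x = q.map .bit) (ht : s t = []) :
    ∃ q' : List Bool, q'.length = q.length ∧ wordValue q' = wordValue q - 1 ∧
      Takes (decrement x t y) s
        s⟦x ↦ q'.map .bit⟧⟦y ↦ .bit (decide (0 < wordValue q)) :: s y⟧ (4 * q.length + 5) := by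
  simp only [List.nodup_cons, List.mem_cons, not_or, List.not_mem_nil, not_false_eq_true,
    and_true, List.nodup_nil] at hd
  obtain ⟨⟨hxt, hxy⟩, hty⟩ := hd
  rcases exists_leading_false q with ⟨i, rfl⟩ | ⟨i, r, rfl⟩
  · refine ⟨List.replicate i false, rfl, by simp [wordValue_replicate_false], ?_⟩
    refine ((moveWhile_takes hxt (r := []) rfl (List.replicate i (.bit false)) ?_ s ?_).seq
      (Takes.ite_false ?_ ((rewind_takes (Ne.symm hxt) _).seq (Takes.act _ _)))).to ?_ ?_
    · simp
    · simp [hs]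
    · simp [stackTops, hxt]
    · simp only [StackOp.runAll, StackOp.run]
      funext k
      simp only [Function.update_apply]
      split_ifs <;> simp_all [wordValue_replicate_false]
    · simp [ht]; omega
  · refine ⟨List.replicate i true ++ false :: r, by simp, by simp [wordValue_borrow], ?_⟩
    refine ((moveWhile_takes hxt (r := .bit true :: r.map .bit) rfl
      (List.replicate i (.bit false)) ?_ s ?_).seq
      (Takes.ite_true ?_ ((Takes.act _ _).seq ((fill_takes hxt _ (List.replicate i (.bit false))
        ?_).seq (Takes.act _ _))))).to ?_ ?_
    · simp
    · simp [hs]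
    · simp [stackTops, hxt]
    · simp [StackOp.runAll, StackOp.run, Ne.symm hxt, ht]
    · simp only [StackOp.runAll, StackOp.run]
      funext k
      simp only [Function.update_apply]
      split_ifs <;> simp_all [wordValue_borrow]
    · simp; omega

/-- Reads blocks that end with the symbol `sep` from `inp` to `dst`, until the condition `halts`
holds. For every block, the number on `x` is decremented. -/
def readBlocks (halts : Option InputSymbol → Bool) (sep : InputSymbol) (inp dst x t y : K) :
    StackProg K InputSymbol :=
  .while (fun h => !halts (h inp))
    (.seq (moveWhile (fun a => a ≠ sep) inp dst)
      (.seq (.act [.move inp dst]) (decrement x t y)))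

/-- One decrement per block turns a binary number into unary, capped at the number of blocks, and
leaves the truncated difference on `x`. The cost stays polynomial even for an exponentially large
number. -/
theorem readBlocks_takes {halts : Option InputSymbol → Bool} {sep : InputSymbol}
    {inp dst x t y : K} (hd : [inp, dst, x, t, y].Nodup) {r : List InputSymbol}
    (hr : halts r.head? = true) (l : List (List InputSymbol)) (hl : ∀ u ∈ l, sep ∉ u)
    (hl' : ∀ u ∈ l, halts (u ++ [sep]).head? = false)
    (q : List Bool) (s : K → List InputSymbol) (hs : s inp = l.flatMap (fun u => u ++ [sep]) ++ r)
    (hx : s x = q.map .bit) (ht : s t = []) :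
    ∃ q' : List Bool, q'.length = q.length ∧ wordValue q' = wordValue q - l.length ∧
      Takes (readBlocks halts sep inp dst x t y) s
        s⟦inp ↦ r⟧⟦dst ↦ (l.flatMap (fun u => u ++ [sep])).reverse ++ s dst⟧⟦x ↦ q'.map .bit⟧⟦y ↦
          ((unaryBits l.length (wordValue q)).map .bit).reverse ++ s y⟧
        (2 * (l.flatMap (fun u => u ++ [sep])).length + (4 * q.length + 7) * l.length + 1) := by
  have hd' := hd
  simp only [List.nodup_cons, List.mem_cons, not_or, List.not_mem_nil, not_false_eq_true,
    and_true, List.nodup_nil] at hd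
  obtain ⟨⟨h₁, h₂, h₃, h₄⟩, ⟨h₅, h₆, h₇⟩, ⟨h₈, h₉⟩, h₁₀⟩ := hd
  induction l generalizing s q with
  | nil =>
    refine ⟨q, rfl, rfl, (Takes.while_false ?_).to ?_ (by simp)⟩
    · simp only [List.flatMap_nil, List.nil_append] at hs
      simp [stackTops, hs, hr]
    · funext k
      simp only [Function.update_apply]
      split_ifs <;> simp_all [unaryBits]
  | cons u l ih =>
    have hu := hl u (by simp)
    have hm := (moveWhile_takes h₁ (c := fun a => decide (a ≠ sep))
      (r := sep :: (l.flatMap (fun u => u ++ [sep]) ++ r)) (by simp) u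
      (by intro a ha; simp; rintro rfl; exact hu ha) s (by simp [hs])).seq (Takes.act [.move inp dst] _)
    obtain ⟨s₁, hs₁⟩ : ∃ s₁, s₁ = s⟦inp ↦ l.flatMap (fun u => u ++ [sep]) ++ r⟧⟦dst ↦
      (u ++ [sep]).reverse ++ s dst⟧ := ⟨_, rfl⟩
    replace hm := hm.to (s' := s₁) (by
      simp only [StackOp.runAll, StackOp.run, Function.update_of_ne h₁, Function.update_self]
      rw [hs₁]
      funext k
      simp only [Function.update_apply]
      split_ifs <;> simp_all) le_rfl
    obtain ⟨q₁, hq₁, hv₁, hdec⟩ := decrement_takes (x := x) (t := t) (y := y)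
      (by simp [*]) q s₁ (by simp [hs₁, Ne.symm h₂, Ne.symm h₅, hx])
      (by simp [hs₁, Ne.symm h₃, Ne.symm h₆, ht])
    obtain ⟨q', hq', hv', hrec⟩ := ih (fun u hu => hl u (by simp [hu]))
      (fun u hu => hl' u (by simp [hu])) q₁
      s₁⟦x ↦ q₁.map .bit⟧⟦y ↦ .bit (decide (0 < wordValue q)) :: s₁ y⟧
      (by simp [*]) (by simp [*]) (by simp [Ne.symm h₃, Ne.symm h₆, Ne.symm h₈, *])
    refine ⟨q', hq'.trans hq₁, by simp only [List.length_cons]; omega, ?_⟩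
    obtain ⟨m, hm, hrun⟩ := hm
    have hbody : Takes (.seq (moveWhile (fun a => a ≠ sep) inp dst)
      (.seq (.act [.move inp dst]) (decrement x t y))) s
      s₁⟦x ↦ q₁.map .bit⟧⟦y ↦ .bit (decide (0 < wordValue q)) :: s₁ y⟧
      (2 * u.length + 1 + 1 + (4 * q.length + 5)) := by
      -- The run of the first two commands is taken apart because the loop body brackets the three
      -- commands the other way.
      obtain ⟨n, hn, hdec⟩ := hdec
      cases hrun with
      | seq ha hb => exact ⟨_, by omega, .seq ha (.seq hb hdec)⟩
    refine (Takes.while_true ?_ hbody hrec).to ?_ ?_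
    · have := hl' u (by simp)
      rw [Bool.not_eq_true', stackTops, hs, ← this]
      cases u <;> simp
    · rw [hs₁]
      funext k
      simp only [Function.update_apply]
      split_ifs <;> simp_all [unaryBits]
    · simp only [List.flatMap_cons, List.length_append, List.length_cons, List.length_nil, hq₁]
      ring_nf; omega

end StackProg

/-! ### The test of a selection of voters -/

/-- The stacks of the machine for Hidden-ID. -/
inductive Stk where
  | inp | num₁ | num₂ | tmp | marks | marksRev | sel | selRev | cand | candRev | bal | balRev
  | lev | levRev | new | pat | patRev | fail | found | bad | zeros | ones | ans | go
  deriving DecidableEq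

instance : Fintype Stk where
  elems := {.inp, .num₁, .num₂, .tmp, .marks, .marksRev, .sel, .selRev, .cand, .candRev, .bal,
    .balRev, .lev, .levRev, .new, .pat, .patRev, .fail, .found, .bad, .zeros, .ones, .ans, .go}
  complete x := by cases x <;> decide

/-- A Boolean on a stack: empty for `false`, a single mark for `true`. -/
def encodeFlag (b : Bool) : List InputSymbol := if b then [.endList] else []

@[simp] theorem encodeFlag_false : encodeFlag false = [] := rfl

@[simp] theorem encodeFlag_true : encodeFlag true = [.endList] := rfl

@[simp] theorem encodeWords_nil : encodeWords [] = [] := rfl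

@[simp] theorem encodeWords_cons (w : List Bool) (l : List (List Bool)) :
    encodeWords (w :: l) = encodeWord w ++ encodeWords l := rfl

@[simp] theorem encodeWords_append (l l' : List (List Bool)) :
    encodeWords (l ++ l') = encodeWords l ++ encodeWords l' := List.flatMap_append

@[simp] theorem encodeTable_nil : encodeTable [] = [] := rfl

@[simp] theorem encodeTable_cons (w : List (List Bool)) (l : List (List (List Bool))) :
    encodeTable (w :: l) = encodeWords w ++ .endList :: encodeTable l := by
  simp [encodeTable]

@[simp] theorem length_encodeWord (w : List Bool) : (encodeWord w).length = w.length + 1 := by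
  simp [encodeWord]

theorem length_le_length_encodeWords (l : List (List Bool)) :
    l.length ≤ (encodeWords l).length := by
  induction l with
  | nil => simp
  | cons w l ih => simp; omega

/-- This includes the empty word, which is the name of candidate `0`: its end mark is still on top.
-/
theorem encodeWord_head_ne (w : List Bool) (r : List InputSymbol) :
    (encodeWord w ++ r).head? ≠ some .endList := by
  cases w <;> simp [encodeWord]

theorem encodeWord_head_isSome (w : List Bool) (r : List InputSymbol) :
    (encodeWord w ++ r).head?.isSome = true := by
  cases w <;> simp [encodeWord]

theorem encodeWords_reverse_head (q : List (List Bool)) :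
    (encodeWords q).reverse.head?.any InputSymbol.isBit = false := by
  rcases List.eq_nil_or_concat q with rfl | ⟨q, w, rfl⟩
  · rfl
  · simp [encodeWord, InputSymbol.isBit]

/-- Strip the longest common prefix. The end marks ensure that the next symbols differ even if one
word is a proper prefix of the other. -/
theorem eq_or_exists_common_prefix (w v : List Bool) :
    w = v ∨ ∃ u w' v', w = u ++ w' ∧ v = u ++ v' ∧ ∀ r r',
      (encodeWord w' ++ r).head? ≠ (encodeWord v' ++ r').head? := by
  induction w generalizing v with
  | nil =>
    cases v with
    | nil => exact Or.inl rfl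
    | cons b v => exact Or.inr ⟨[], [], b :: v, rfl, rfl, by simp [encodeWord]⟩
  | cons a w ih =>
    cases v with
    | nil => exact Or.inr ⟨[], a :: w, [], rfl, rfl, by simp [encodeWord]⟩
    | cons b v =>
      by_cases h : a = b
      · subst h
        rcases ih v with rfl | ⟨u, w', v', rfl, rfl, h⟩
        · exact Or.inl rfl
        · exact Or.inr ⟨a :: u, w', v', rfl, rfl, h⟩
      · exact Or.inr ⟨[], a :: w, b :: v, rfl, rfl, by simp [encodeWord, h]⟩

/-! ### Searching the ballots for a pattern -/

namespace StackProg

open Stk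

/-- Moves the common prefix of the words on `bal` and `pat`. -/
def prefixProg : StackProg Stk InputSymbol :=
  .while (fun t => t bal = t pat ∧ (t bal).any InputSymbol.isBit)
    (.act [.move bal balRev, .move pat patRev])

/-- Reads a word from `bal`; if `pat` starts with the same word, that is moved to `patRev`. -/
def itemProg : StackProg Stk InputSymbol :=
  .seq prefixProg (.seq
    (.ite (fun t => t bal = t pat) (.act [.move pat patRev])
      (moveWhile InputSymbol.isBit patRev pat))
    (moveWord bal balRev))

theorem prefixProg_takes (u : List Bool) (r r' : List InputSymbol)
    (hr : r.head? = r'.head? → r.head?.any InputSymbol.isBit = false)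
    (s : Stk → List InputSymbol) (hb : s bal = u.map .bit ++ r) (hp : s pat = u.map .bit ++ r') :
    Takes prefixProg s s⟦bal ↦ r⟧⟦pat ↦ r'⟧⟦balRev ↦ (u.map .bit).reverse ++ s balRev⟧⟦patRev ↦
      (u.map .bit).reverse ++ s patRev⟧ (2 * u.length + 1) := by
  induction u generalizing s with
  | nil =>
    simp only [List.map_nil, List.nil_append] at hb hp
    refine (Takes.while_false ?_).to ?_ (by simp)
    · simp only [stackTops, hb, hp, decide_eq_false_iff_not, not_and, Bool.not_eq_true]
      exact hr
    · simp [← hb, ← hp]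
  | cons a u ih =>
    have hm : StackOp.runAll [.move bal balRev, .move pat patRev] s =
        s⟦bal ↦ u.map .bit ++ r⟧⟦pat ↦ u.map .bit ++ r'⟧⟦balRev ↦ .bit a :: s balRev⟧⟦patRev ↦
          .bit a :: s patRev⟧ := by
      simp only [StackOp.runAll, StackOp.run, hb, hp, List.map_cons, List.cons_append, ne_eq,
        reduceCtorEq, not_false_eq_true, Function.update_of_ne]
      funext k
      cases k <;> simp
    refine (Takes.while_true ?_ (Takes.act _ s) (ih _ ?_ ?_)).to ?_ ?_
    · simp [stackTops, hb, hp, InputSymbol.isBit]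
    · simp [hm]
    · simp [hm]
    · rw [hm]
      funext k
      cases k <;> simp
    · simp; omega

theorem itemProg_takes_of_match (w : List Bool) (r r' : List InputSymbol)
    (s : Stk → List InputSymbol) (hb : s bal = encodeWord w ++ r) (hp : s pat = encodeWord w ++ r') :
    Takes itemProg s s⟦bal ↦ r⟧⟦pat ↦ r'⟧⟦balRev ↦ (encodeWord w).reverse ++ s balRev⟧⟦patRev ↦
      (encodeWord w).reverse ++ s patRev⟧ (10 * (encodeWord w).length) := by
  refine ((prefixProg_takes w (.endNumber :: r) (.endNumber :: r') (fun _ => rfl) s ?_ ?_).seq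
    ((Takes.ite_true ?_ (Takes.act _ _)).seq (moveWord_takes (by decide) [] r _ ?_))).to ?_ ?_
  · simp [hb, encodeWord]
  · simp [hp, encodeWord]
  · simp [stackTops]
  · simp [StackOp.runAll, StackOp.run, encodeWord]
  · simp only [StackOp.runAll, StackOp.run, ne_eq,
      reduceCtorEq, not_false_eq_true, Function.update_of_ne, Function.update_self]
    funext k
    cases k <;> simp [encodeWord]
  · simp; omega

/-- The partially matched prefix is put back on `pat`. This return stops at the right place because
below the prefix `patRev` is empty or shows the end mark of the last word matched completely. -/
theorem itemProg_takes_of_mismatch (w : List Bool) (p q : List (List Bool)) (hwp : p.head? ≠ some w)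
    (r : List InputSymbol)
    (s : Stk → List InputSymbol) (hb : s bal = encodeWord w ++ r)
    (hp : s pat = encodeWords p ++ [.endList]) (hq : s patRev = (encodeWords q).reverse) :
    Takes itemProg s s⟦bal ↦ r⟧⟦balRev ↦ (encodeWord w).reverse ++ s balRev⟧
      (10 * (encodeWord w).length) := by
  obtain ⟨u, w', r', hw, hp', hne⟩ : ∃ (u w' : List Bool) (r' : List InputSymbol), w = u ++ w' ∧
      s pat = u.map .bit ++ r' ∧ (encodeWord w' ++ r).head? ≠ r'.head? := by
    cases p with
    -- An exhausted pattern shows `endList`, which no word on the ballot can match.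
    | nil => exact ⟨[], w, _, rfl, hp, by simpa using encodeWord_head_ne w r⟩
    | cons v p =>
      rcases eq_or_exists_common_prefix w v with rfl | ⟨u, w', v', hw, rfl, hne⟩
      · simp at hwp
      · exact ⟨u, w', encodeWord v' ++ (encodeWords p ++ [.endList]), hw,
          by simp [hp, encodeWord], hne _ _⟩
  refine ((prefixProg_takes u (encodeWord w' ++ r) r' (fun h => absurd h hne) s ?_ hp').seq
    ((Takes.ite_false ?_ (moveWhile_takes (r := (encodeWords q).reverse) (by decide)
      (encodeWords_reverse_head q) (u.map .bit).reverse ?_ _ ?_)).seq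
      (moveWord_takes (by decide) w' r _ ?_))).to ?_ ?_
  · simp [hb, hw, encodeWord]
  · simpa [stackTops] using hne
  · intro a ha
    exact InputSymbol.isBit_of_mem_map (List.mem_reverse.1 ha)
  · simp [hq]
  · simp
  · funext k
    cases k <;> simp [encodeWord, hp', hq, hw]
  · simp [hw]; omega

/-- Reads a ballot from `bal`, searching it for the pattern on `pat`. -/
def ballotProg : StackProg Stk InputSymbol := .while (fun t => t bal ≠ some .endList) itemProg

/-- Greedy matching decides sublists, and `List.isSublist` recurses in the same way as the loop. The
words matched so far are `q'`; the equation `q' ++ p' = q ++ p` is what allows the pattern to be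
restored for the next voter. -/
theorem ballotProg_takes (l p q : List (List Bool)) (r : List InputSymbol)
    (s : Stk → List InputSymbol) (hb : s bal = encodeWords l ++ .endList :: r)
    (hp : s pat = encodeWords p ++ [.endList]) (hq : s patRev = (encodeWords q).reverse) :
    ∃ p' q' : List (List Bool), q' ++ p' = q ++ p ∧ (p' = [] ↔ p.isSublist l = true) ∧
      Takes ballotProg s s⟦bal ↦ .endList :: r⟧⟦balRev ↦ (encodeWords l).reverse ++ s balRev⟧⟦pat ↦
        encodeWords p' ++ [.endList]⟧⟦patRev ↦ (encodeWords q').reverse⟧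
        (11 * (encodeWords l).length + 1) := by
  unfold ballotProg
  induction l generalizing s p q with
  | nil =>
    refine ⟨p, q, rfl, by cases p <;> simp [List.isSublist], (Takes.while_false ?_).to ?_ (by simp)⟩
    · simp [stackTops, hb]
    · funext k
      cases k <;> simp [hb, hp, hq]
  | cons w l ih =>
    have hc : decide (stackTops s bal ≠ some .endList) = true := by
      rw [stackTops, hb, encodeWords_cons, List.append_assoc]
      exact decide_eq_true (encodeWord_head_ne w _)
    by_cases h : p.head? = some w
    · obtain ⟨p, rfl⟩ : ∃ p', p = w :: p' := by
        cases p with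
        | nil => simp at h
        | cons v p => simp at h; exact ⟨p, by rw [h]⟩
      obtain ⟨p', q', h₁, h₂, h₃⟩ := ih p (q ++ [w]) s⟦bal ↦ encodeWords l ++ .endList :: r⟧⟦pat ↦
        encodeWords p ++ [.endList]⟧⟦balRev ↦ (encodeWord w).reverse ++ s balRev⟧⟦patRev ↦
        (encodeWord w).reverse ++ s patRev⟧ (by simp) (by simp) (by simp [hq])
      refine ⟨p', q', by simp [h₁], by simp [h₂, List.isSublist], (Takes.while_true hc
        (itemProg_takes_of_match w (encodeWords l ++ .endList :: r) (encodeWords p ++ [.endList])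
          s (by simp [hb]) (by simp [hp])) h₃).to ?_ ?_⟩
      · funext k
        cases k <;> simp
      · simp; omega
    · obtain ⟨p', q', h₁, h₂, h₃⟩ := ih p q s⟦bal ↦ encodeWords l ++ .endList :: r⟧⟦balRev ↦
        (encodeWord w).reverse ++ s balRev⟧ (by simp) (by simp [hp]) (by simp [hq])
      refine ⟨p', q', h₁, ?_, (Takes.while_true hc
        (itemProg_takes_of_mismatch w p q h (encodeWords l ++ .endList :: r)
          s (by simp [hb]) hp hq) h₃).to ?_ ?_⟩
      · rw [h₂]
        cases p with
        | nil => simp [List.isSublist]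
        | cons v p =>
          have : v ≠ w := by simpa using h
          simp [List.isSublist, this]
      · funext k
        cases k <;> simp
      · simp; omega

/-- Sets a flag. -/
def setFlag (x : Stk) : StackProg Stk InputSymbol := .act [.drop x, .push x .endList]

theorem setFlag_takes (x : Stk) (b : Bool) (s : Stk → List InputSymbol) (h : s x = encodeFlag b) :
    Takes (setFlag x) s s⟦x ↦ encodeFlag true⟧ 1 := by
  refine (Takes.act _ s).to ?_ le_rfl
  cases b <;> simp [StackOp.runAll, StackOp.run, h]

theorem Takes.skip (s : Stk → List InputSymbol) : Takes (.act []) s s 1 := Takes.act [] s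

/-- Reads the ballot of a voter, and sets `fail` if the voter is selected but the ballot does not
contain the pattern. -/
def voterProg : StackProg Stk InputSymbol :=
  .seq ballotProg (.seq
    (.ite (fun t => t sel = some (.bit true) ∧ t pat ≠ some .endList) (setFlag fail) (.act []))
    (.seq (.act [.move bal balRev, .move sel selRev]) (rewind patRev pat)))

theorem voterProg_takes (l p : List (List Bool)) (b f : Bool) (r r' : List InputSymbol)
    (s : Stk → List InputSymbol) (hb : s bal = encodeWords l ++ .endList :: r)
    (hs : s sel = .bit b :: r')
    (hp : s pat = encodeWords p ++ [.endList]) (hq : s patRev = []) (hf : s fail = encodeFlag f) :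
    Takes voterProg s s⟦bal ↦ r⟧⟦balRev ↦ .endList :: (encodeWords l).reverse ++ s balRev⟧⟦sel ↦
      r'⟧⟦selRev ↦ .bit b :: s selRev⟧⟦fail ↦ encodeFlag (f || (b && !p.isSublist l))⟧
      (11 * (encodeWords l).length + 2 * (encodeWords p).length + 5) := by
  obtain ⟨p', q', h₁, h₂, h₃⟩ := ballotProg_takes l p [] r s hb hp hq
  have hlen : (encodeWords q').length ≤ (encodeWords p).length := by
    have := congrArg (fun l => (encodeWords l).length) h₁
    simp at this
    omega
  have h₄ : encodeWords q' ++ encodeWords p' = encodeWords p := by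
    rw [← encodeWords_append, h₁]; rfl
  obtain ⟨s₁, hs₁⟩ : ∃ s₁, s₁ = s⟦bal ↦ .endList :: r⟧⟦balRev ↦
    (encodeWords l).reverse ++ s balRev⟧⟦pat ↦ encodeWords p' ++ [.endList]⟧⟦patRev ↦
    (encodeWords q').reverse⟧ := ⟨_, rfl⟩
  have hi : Takes (.ite (fun t => t sel = some (.bit true) ∧ t pat ≠ some .endList) (setFlag fail)
      (.act [])) s₁ s₁⟦fail ↦ encodeFlag (f || (b && !p.isSublist l))⟧ 2 := by
    have hpat : (s₁ pat).head? = some .endList ↔ p.isSublist l = true := by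
      have e : s₁ pat = encodeWords p' ++ [.endList] := by simp [hs₁]
      rw [← h₂, e]
      cases p' with
      | nil => simp
      | cons w p' =>
        rw [encodeWords_cons, List.append_assoc]
        simp only [encodeWord_head_ne, reduceCtorEq]
    have hsel : (s₁ sel).head? = some (.bit b) := by simp [hs₁, hs]
    by_cases hc : b = true ∧ ¬ p.isSublist l = true
    · refine (Takes.ite_true ?_ (setFlag_takes fail f s₁ (by simp [hs₁, hf]))).to ?_ le_rfl
      · rw [decide_eq_true_eq, stackTops, stackTops, hsel, Ne, hpat, hc.1]
        exact ⟨rfl, hc.2⟩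
      · simp [hc.1, hc.2]
    · refine (Takes.ite_false ?_ (Takes.skip s₁)).to ?_ le_rfl
      · rw [decide_eq_false_iff_not, stackTops, stackTops, hsel, Ne, hpat]
        simpa using hc
      · have : (b && !p.isSublist l) = false := by
          cases b <;> simp_all
        rw [this, Bool.or_false]
        funext k
        cases k <;> simp [hs₁, hf]
  rw [← hs₁] at h₃
  refine (h₃.seq (hi.seq ((Takes.act _ _).seq (rewind_takes (by decide) _)))).to ?_ ?_
  · simp only [StackOp.runAll, StackOp.run, hs₁, ne_eq,
      reduceCtorEq, not_false_eq_true, Function.update_of_ne, Function.update_self, hs]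
    funext k
    cases k <;> simp [hp, hq, ← h₄]
  · simp [StackOp.runAll, StackOp.run, hs₁, hs]; omega

end StackProg

/-! ### The levels of the dominance relation -/

/-- All ballots selected by `bs` contain the pattern `p`. -/
def agree (bs : List Bool) (bls : List (List (List Bool))) (p : List (List Bool)) : Bool :=
  (bs.zip bls).all fun x => !x.1 || p.isSublist x.2

/-- The candidates of `C` that are, for some `d` in `R`, less preferred than `d` by all selected
voters. -/
def nextLevel (bs : List Bool) (bls : List (List (List Bool))) (C R : List (List Bool)) :
    List (List Bool) :=
  C.filter fun c => R.any fun d => agree bs bls [d, c]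

/-- The next `k` levels from `R` on are all nonempty. -/
def levelsNonempty (bs : List Bool) (bls : List (List (List Bool))) (C : List (List Bool)) :
    ℕ → List (List Bool) → Bool
  | 0, _ => true
  | k + 1, R => !R.isEmpty && levelsNonempty bs bls C k (nextLevel bs bls C R)

theorem length_encodeWords_filter_le (f : List Bool → Bool) (l : List (List Bool)) :
    (encodeWords (l.filter f)).length ≤ (encodeWords l).length := by
  induction l with
  | nil => simp
  | cons w l ih =>
    by_cases h : f w = true
    · simpa [h] using ih
    · simp [h]; omega

theorem length_encodeWord_le_of_mem {w : List Bool} {l : List (List Bool)} (h : w ∈ l) :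
    (encodeWord w).length ≤ (encodeWords l).length := by
  obtain ⟨l₁, l₂, rfl⟩ := List.append_of_mem h
  simp; omega

namespace StackProg

open Stk

/-- Reads all ballots. -/
def votersProg : StackProg Stk InputSymbol := .while (fun t => (t sel).isSome) voterProg

theorem votersProg_takes (p : List (List Bool)) (bs : List Bool) (bls : List (List (List Bool)))
    (hl : bs.length = bls.length) (f : Bool) (s : Stk → List InputSymbol)
    (hb : s bal = encodeTable bls) (hs : s sel = bs.map .bit)
    (hp : s pat = encodeWords p ++ [.endList]) (hq : s patRev = []) (hf : s fail = encodeFlag f) :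
    Takes votersProg s s⟦bal ↦ []⟧⟦balRev ↦ (encodeTable bls).reverse ++ s balRev⟧⟦sel ↦
      []⟧⟦selRev ↦ (bs.map .bit).reverse ++ s selRev⟧⟦fail ↦ encodeFlag (f || !agree bs bls p)⟧
      (11 * (encodeTable bls).length + (2 * (encodeWords p).length + 6) * bs.length + 1) := by
  unfold votersProg
  induction bs generalizing s bls f with
  | nil =>
    obtain rfl : bls = [] := by simpa using hl.symm
    refine (Takes.while_false ?_).to ?_ (by simp)
    · simp [stackTops, hs]
    · simp only [encodeTable_nil] at hb
      funext k
      cases k <;> simp [hb, hs, hf, agree]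
  | cons b bs ih =>
    obtain ⟨l, bls, rfl⟩ : ∃ l bls', bls = l :: bls' := by
      cases bls with
      | nil => simp at hl
      | cons l bls => exact ⟨l, bls, rfl⟩
    refine (Takes.while_true ?_ (voterProg_takes l p b f (encodeTable bls) (bs.map .bit) s
      (by simp [hb]) (by simp [hs]) hp hq hf)
      (ih bls (by simpa using hl) (f || (b && !p.isSublist l)) _ (by simp) (by simp) (by simp [hp])
        (by simp [hq]) (by simp))).to ?_ ?_
    · simp [stackTops, hs]
    · have h : (f || (b && !p.isSublist l) || !agree bs bls p) =
          (f || !agree (b :: bs) (l :: bls) p) := by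
        simp only [agree, List.zip_cons_cons, List.all_cons]
        cases f <;> cases b <;> cases p.isSublist l <;> simp
      rw [h]
      funext k
      cases k <;> simp
    · simp only [List.length_cons, encodeTable_cons, List.length_append]
      ring_nf; omega

/-- The stacks hold the selection `bs` and the ballots `bls`, of length at most `N`. -/
structure TestData (N : ℕ) (bs : List Bool) (bls : List (List (List Bool)))
    (s : Stk → List InputSymbol) : Prop where
  length_eq : bs.length = bls.length
  length_le : bs.length ≤ N
  size_le : (encodeTable bls).length ≤ N
  sel : s sel = bs.map .bit
  selRev : s selRev = []
  bal : s bal = encodeTable bls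
  balRev : s balRev = []
  patRev : s patRev = []
  tmp : s tmp = []
  fail : s fail = []

theorem TestData.update {N : ℕ} {bs : List Bool} {bls : List (List (List Bool))}
    {s : Stk → List InputSymbol} (h : TestData N bs bls s) (k : Stk) (l : List InputSymbol)
    (hk : k ∉ [Stk.sel, Stk.selRev, Stk.bal, Stk.balRev, Stk.patRev, Stk.tmp, Stk.fail]) :
    TestData N bs bls s⟦k ↦ l⟧ := by
  simp only [List.mem_cons, not_or, List.not_mem_nil, not_false_eq_true, and_true] at hk
  obtain ⟨h₁, h₂, h₃, h₄, h₅, h₆, h₇⟩ := hk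
  constructor <;> simp [Ne.symm h₁, Ne.symm h₂, Ne.symm h₃, Ne.symm h₄, Ne.symm h₅, Ne.symm h₆,
    Ne.symm h₇, h.length_eq, h.size_le, h.sel, h.selRev, h.bal, h.balRev, h.patRev, h.tmp, h.fail]
  simp [← h.length_eq, h.length_le]

/-- Sets `fail` if some selected ballot does not contain the pattern. -/
def testProg : StackProg Stk InputSymbol :=
  .seq votersProg (.seq (rewind selRev sel) (rewind balRev bal))

/-- The time of `testProg` for a pattern of size at most `2 * N`. -/
def testTime {R : Type*} [CommSemiring R] (N : R) : R := (4 * N + 6) * N + 15 * N + 3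

/-- Ballots and selection are rewound, so only `fail` changes and the test can be repeated. The
bound `2 * N` accommodates patterns of two names. -/
theorem testProg_takes {N : ℕ} {bs : List Bool} {bls : List (List (List Bool))}
    (p : List (List Bool)) (s : Stk → List InputSymbol) (h : TestData N bs bls s)
    (hp : s pat = encodeWords p ++ [.endList]) (hpN : (encodeWords p).length ≤ 2 * N) :
    Takes testProg s s⟦Stk.fail ↦ encodeFlag (!agree bs bls p)⟧ (testTime N) := by
  refine ((votersProg_takes p bs bls h.length_eq false s h.bal h.sel hp h.patRev h.fail).seq
    ((rewind_takes (by decide) _).seq (rewind_takes (by decide) _))).to ?_ ?_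
  · funext k
    cases k <;> simp [h.sel, h.selRev, h.bal, h.balRev]
  · have h₁ := h.length_le
    have h₂ := h.size_le
    have h₃ : (2 * (encodeWords p).length + 6) * bs.length ≤ (4 * N + 6) * N :=
      Nat.mul_le_mul (by omega) h₁
    simp [h.selRev, h.balRev, testTime]
    omega

/-- Tests the pattern formed by a word from `lev` and the word on `pat`; sets `found` if the test
succeeds. -/
def innerProg : StackProg Stk InputSymbol :=
  .seq (copyWord lev levRev tmp pat) (.seq testProg (.seq
    (.ite (fun t => (t fail).isNone) (setFlag found) (.act []))
    (.seq (.act [.drop fail]) (dropWord pat))))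

/-- Copying `d` above `c` forms the pattern `[d, c]`, which a ballot contains exactly if it ranks
`d` before `c`; the sublist test thus tests dominance. -/
theorem innerProg_takes {N : ℕ} {bs : List Bool} {bls : List (List (List Bool))}
    (c d : List Bool) (f : Bool) (r : List InputSymbol)
    (s : Stk → List InputSymbol) (h : TestData N bs bls s)
    (hp : s pat = encodeWord c ++ [.endList]) (hr : s lev = encodeWord d ++ r)
    (hf : s found = encodeFlag f)
    (hc : (encodeWord c).length ≤ N) (hd : (encodeWord d).length ≤ N) :
    Takes innerProg s s⟦lev ↦ r⟧⟦levRev ↦ (encodeWord d).reverse ++ s levRev⟧⟦found ↦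
      encodeFlag (f || agree bs bls [d, c])⟧ (testTime N + 6 * N + 3) := by
  have h₁ := copyWord_takes (x := lev) (y := levRev) (t := tmp) (z := pat) (by decide) d r s hr h.tmp
  obtain ⟨s₁, hs₁⟩ : ∃ s₁, s₁ = s⟦lev ↦ r⟧⟦levRev ↦ (encodeWord d).reverse ++ s levRev⟧⟦pat ↦
    encodeWord d ++ s pat⟧ := ⟨_, rfl⟩
  rw [← hs₁] at h₁
  have h₂ := testProg_takes (N := N) (bs := bs) (bls := bls) [d, c] s₁
    (by rw [hs₁]; exact ((h.update _ _ (by decide)).update _ _ (by decide)).update _ _ (by decide))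
    (by simp [hs₁, hp]) (by simp at hc hd ⊢; omega)
  have h₃ : Takes (.ite (fun t => (t Stk.fail).isNone) (setFlag found) (.act []))
      s₁⟦Stk.fail ↦ encodeFlag (!agree bs bls [d, c])⟧
      s₁⟦Stk.fail ↦ encodeFlag (!agree bs bls [d, c])⟧⟦found ↦
        encodeFlag (f || agree bs bls [d, c])⟧ 2 := by
    cases agree bs bls [d, c] with
    | true =>
      exact (Takes.ite_true (by simp [stackTops])
        (setFlag_takes found f _ (by simp [hs₁, hf]))).to (by simp) le_rfl
    | false =>
      refine (Takes.ite_false (by simp [stackTops]) (Takes.skip _)).to ?_ le_rfl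
      funext k
      cases k <;> simp [hs₁, hf]
  refine (h₁.seq (h₂.seq (h₃.seq ((Takes.act _ _).seq
    (dropWord_takes pat d (s pat) _ ?_))))).to ?_ ?_
  · simp [StackOp.runAll, StackOp.run, hs₁]
  · funext k
    cases k <;> simp [StackOp.runAll, StackOp.run, hs₁, h.fail]
    cases agree bs bls [d, c] <;> simp
  · omega

/-- Runs `innerProg` for all words on `lev`. -/
def innerLoop : StackProg Stk InputSymbol := .while (fun t => (t lev).isSome) innerProg

theorem innerLoop_takes {N : ℕ} {bs : List Bool} {bls : List (List (List Bool))}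
    (c : List Bool) (R : List (List Bool)) (f : Bool)
    (s : Stk → List InputSymbol) (h : TestData N bs bls s)
    (hp : s pat = encodeWord c ++ [.endList]) (hr : s lev = encodeWords R)
    (hf : s found = encodeFlag f)
    (hc : (encodeWord c).length ≤ N) (hd : ∀ d ∈ R, (encodeWord d).length ≤ N) :
    Takes innerLoop s s⟦lev ↦ []⟧⟦levRev ↦ (encodeWords R).reverse ++ s levRev⟧⟦found ↦
      encodeFlag (f || R.any fun d => agree bs bls [d, c])⟧
      ((testTime N + 6 * N + 4) * R.length + 1) := by
  unfold innerLoop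
  induction R generalizing s f with
  | nil =>
    refine (Takes.while_false ?_).to ?_ (by simp)
    · simp [stackTops, hr]
    · funext k
      cases k <;> simp [hr, hf]
  | cons d R ih =>
    refine (Takes.while_true ?_ (innerProg_takes c d f (encodeWords R) s h hp (by simp [hr]) hf hc
      (hd d (by simp))) (ih (f || agree bs bls [d, c]) _
        (((h.update _ _ (by decide)).update _ _ (by decide)).update _ _ (by decide))
        (by simp [hp]) (by simp) (by simp) (fun d hd' => hd d (by simp [hd'])))).to ?_ ?_
    · rw [stackTops, hr, encodeWords_cons]
      exact encodeWord_head_isSome d _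
    · rw [List.any_cons, ← Bool.or_assoc]
      funext k
      cases k <;> simp
    · simp only [List.length_cons]
      ring_nf; omega

/-- Decides whether a word from `cand` belongs to the next level, and puts it on `new` if so. -/
def outerProg : StackProg Stk InputSymbol :=
  .seq (copyWord cand candRev tmp pat) (.seq innerLoop (.seq (rewind levRev lev) (.seq
    (.ite (fun t => (t found).isSome) (moveWord pat new) (dropWord pat)) (.act [.drop found]))))

/-- The stacks hold the candidates `C` and the level `R`, of length at most `N`. -/
structure LevelData (N : ℕ) (R : List (List Bool)) (s : Stk → List InputSymbol) : Prop where
  lev : s lev = encodeWords R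
  levRev : s levRev = []
  pat : s pat = [.endList]
  found : s found = []
  size_le : (encodeWords R).length ≤ N

theorem LevelData.update {N : ℕ} {R : List (List Bool)}
    {s : Stk → List InputSymbol} (h : LevelData N R s) (k : Stk) (l : List InputSymbol)
    (hk : k ∉ [Stk.lev, Stk.levRev, Stk.pat, Stk.found]) :
    LevelData N R s⟦k ↦ l⟧ := by
  simp only [List.mem_cons, not_or, List.not_mem_nil, not_false_eq_true, and_true] at hk
  obtain ⟨h₁, h₂, h₃, h₄⟩ := hk
  constructor <;> simp [Ne.symm h₁, Ne.symm h₂, Ne.symm h₃, Ne.symm h₄, h.lev, h.levRev, h.pat,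
    h.found, h.size_le]

/-- The time of `outerProg`. -/
def outerTime {R : Type*} [CommSemiring R] (N : R) : R :=
  (testTime N + 6 * N + 4) * N + 8 * N + 4

theorem outerProg_takes {N : ℕ} {bs : List Bool} {bls : List (List (List Bool))}
    (c : List Bool) (R : List (List Bool)) (r : List InputSymbol)
    (s : Stk → List InputSymbol) (h : TestData N bs bls s) (h' : LevelData N R s)
    (hr : s cand = encodeWord c ++ r) (hc : (encodeWord c).length ≤ N) :
    Takes outerProg s s⟦cand ↦ r⟧⟦candRev ↦ (encodeWord c).reverse ++ s candRev⟧⟦new ↦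
      (encodeWords ([c].filter fun c => R.any fun d => agree bs bls [d, c])).reverse ++ s new⟧
      (outerTime N) := by
  have h₁ := copyWord_takes (x := cand) (y := candRev) (t := tmp) (z := pat) (by decide) c r s hr
    h.tmp
  obtain ⟨s₁, hs₁⟩ : ∃ s₁, s₁ = s⟦cand ↦ r⟧⟦candRev ↦ (encodeWord c).reverse ++ s candRev⟧⟦pat ↦
    encodeWord c ++ s pat⟧ := ⟨_, rfl⟩
  rw [← hs₁] at h₁
  have h₂ := innerLoop_takes (N := N) (bs := bs) (bls := bls) c R false s₁
    (by rw [hs₁]; exact ((h.update _ _ (by decide)).update _ _ (by decide)).update _ _ (by decide))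
    (by simp [hs₁, h'.pat]) (by simp [hs₁, h'.lev]) (by simp [hs₁, h'.found]) hc
    (fun d hd => (length_encodeWord_le_of_mem hd).trans h'.size_le)
  rw [Bool.false_or] at h₂
  have hR := h'.size_le
  have hR' : (testTime N + 6 * N + 4) * R.length ≤ (testTime N + 6 * N + 4) * N :=
    Nat.mul_le_mul_left _ ((length_le_length_encodeWords R).trans hR)
  generalize hb : (R.any fun d => agree bs bls [d, c]) = b at h₂
  have h₃ := h₂.seq (rewind_takes (x := levRev) (y := lev) (by decide) _)
  obtain ⟨m, hm, hrun⟩ := h₃.to (s' := s₁⟦found ↦ encodeFlag b⟧) (t :=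
    (testTime N + 6 * N + 4) * N + 2 * N + 2) (by
      funext k
      cases k <;> simp [hs₁, h'.lev, h'.levRev]) (by simp [hs₁, h'.levRev]; omega)
  have h₄ : Takes (.ite (fun t => (t found).isSome) (moveWord pat new) (dropWord pat))
      s₁⟦found ↦ encodeFlag b⟧ s₁⟦found ↦ encodeFlag b⟧⟦pat ↦ [.endList]⟧⟦new ↦
      (encodeWords ([c].filter fun _ => b)).reverse ++ s new⟧ (2 * N + 1) := by
    cases b with
    | true =>
      refine (Takes.ite_true (by simp [stackTops])
        (moveWord_takes (by decide) c [.endList] _ (by simp [hs₁, h'.pat]))).to ?_ (by omega)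
      funext k
      cases k <;> simp [hs₁]
    | false =>
      refine (Takes.ite_false (by simp [stackTops])
        (dropWord_takes pat c [.endList] _ (by simp [hs₁, h'.pat]))).to ?_ (by omega)
      funext k
      cases k <;> simp [hs₁]
  have h₅ := h₄.seq (Takes.act [.drop found] _)
  cases hrun with
  | seq ha hb' =>
    obtain ⟨m₁, hm₁, h₁⟩ := h₁
    obtain ⟨m₅, hm₅, h₅⟩ := h₅
    refine Takes.to ⟨_, le_rfl, .seq h₁ (.seq ha (.seq hb' h₅))⟩ ?_ ?_
    · have e : ([c].filter fun c => R.any fun d => agree bs bls [d, c]) =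
          [c].filter fun _ => b := by simp [List.filter_cons, hb]
      rw [e]
      funext k
      cases k <;> simp [StackOp.runAll, StackOp.run, hs₁, h'.pat, h'.found]
      cases b <;> simp
    · unfold outerTime
      omega

/-- Runs `outerProg` for all candidates. -/
def outerLoop : StackProg Stk InputSymbol := .while (fun t => (t cand).isSome) outerProg

theorem outerLoop_takes {N : ℕ} {bs : List Bool} {bls : List (List (List Bool))}
    (C R : List (List Bool))
    (s : Stk → List InputSymbol) (h : TestData N bs bls s) (h' : LevelData N R s)
    (hr : s cand = encodeWords C) (hc : ∀ c ∈ C, (encodeWord c).length ≤ N) :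
    Takes outerLoop s s⟦cand ↦ []⟧⟦candRev ↦ (encodeWords C).reverse ++ s candRev⟧⟦new ↦
      (encodeWords (nextLevel bs bls C R)).reverse ++ s new⟧
      ((outerTime N + 1) * C.length + 1) := by
  unfold outerLoop
  induction C generalizing s with
  | nil =>
    refine (Takes.while_false ?_).to ?_ (by simp)
    · simp [stackTops, hr]
    · funext k
      cases k <;> simp [hr, nextLevel]
  | cons c C ih =>
    refine (Takes.while_true ?_ (outerProg_takes c R (encodeWords C) s h h' (by simp [hr])
      (hc c (by simp))) (ih _
        (((h.update _ _ (by decide)).update _ _ (by decide)).update _ _ (by decide))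
        (((h'.update _ _ (by decide)).update _ _ (by decide)).update _ _ (by decide))
        (by simp) (fun d hd' => hc d (by simp [hd'])))).to ?_ ?_
    · rw [stackTops, hr, encodeWords_cons]
      exact encodeWord_head_isSome c _
    · have e : nextLevel bs bls (c :: C) R =
          ([c].filter fun c => R.any fun d => agree bs bls [d, c]) ++ nextLevel bs bls C R := by
        rw [nextLevel, nextLevel, ← List.filter_append]; rfl
      rw [e]
      funext k
      cases k <;> simp
    · simp only [List.length_cons]
      ring_nf; omega

end StackProg

/-! ### Counting nonempty levels -/

namespace StackProg

open Stk

/-- Replaces the level on `lev` by the next level. -/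
def stepProg : StackProg Stk InputSymbol :=
  .seq outerLoop (.seq (rewind candRev cand) (.seq (clear lev) (rewind new lev)))

/-- The time of `stepProg`. -/
def stepTime {R : Type*} [CommSemiring R] (N : R) : R := (outerTime N + 1) * N + 6 * N + 4

/-- The stacks hold the candidates `C`, of length at most `N`. -/
structure CandData (N : ℕ) (C : List (List Bool)) (s : Stk → List InputSymbol) : Prop where
  cand : s cand = encodeWords C
  candRev : s candRev = []
  new : s new = []
  size_le : (encodeWords C).length ≤ N

theorem CandData.update {N : ℕ} {C : List (List Bool)}
    {s : Stk → List InputSymbol} (h : CandData N C s) (k : Stk) (l : List InputSymbol)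
    (hk : k ∉ [Stk.cand, Stk.candRev, Stk.new]) :
    CandData N C s⟦k ↦ l⟧ := by
  simp only [List.mem_cons, not_or, List.not_mem_nil, not_false_eq_true, and_true] at hk
  obtain ⟨h₁, h₂, h₃⟩ := hk
  constructor <;> simp [Ne.symm h₁, Ne.symm h₂, Ne.symm h₃, h.cand, h.candRev, h.new, h.size_le]

theorem CandData.nextLevel_size_le {N : ℕ} {C : List (List Bool)} {s : Stk → List InputSymbol}
    (h : CandData N C s) (bs : List Bool) (bls : List (List (List Bool)))
    (R : List (List Bool)) : (encodeWords (nextLevel bs bls C R)).length ≤ N :=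
  (length_encodeWords_filter_le _ C).trans h.size_le

theorem stepProg_takes {N : ℕ} {bs : List Bool} {bls : List (List (List Bool))}
    (C R : List (List Bool))
    (s : Stk → List InputSymbol) (h : TestData N bs bls s) (h' : LevelData N R s)
    (hC : CandData N C s) :
    Takes stepProg s s⟦lev ↦ encodeWords (nextLevel bs bls C R)⟧ (stepTime N) := by
  refine ((outerLoop_takes C R s h h' hC.cand
    (fun c hc => (length_encodeWord_le_of_mem hc).trans hC.size_le)).seq
    ((rewind_takes (by decide) _).seq ((clear_takes _ _).seq (rewind_takes (by decide) _)))).to ?_ ?_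
  · funext k
    cases k <;> simp [hC.cand, hC.candRev, hC.new]
  · have h₁ := hC.nextLevel_size_le bs bls R
    have h₂ := hC.size_le
    have h₃ : (outerTime N + 1) * C.length ≤ (outerTime N + 1) * N :=
      Nat.mul_le_mul_left _ ((length_le_length_encodeWords C).trans h₂)
    have h₄ := h'.size_le
    simp [hC.candRev, hC.new, h'.lev, stepTime]
    omega

/-- Sets `bad` if the level is empty, and goes on to the next level. -/
def roundProg : StackProg Stk InputSymbol :=
  .seq (.ite (fun t => (t lev).isSome) (.act []) (setFlag bad))
    (.seq stepProg (.act [.move marks marksRev]))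

/-- Runs `roundProg` for every mark. -/
def roundsProg : StackProg Stk InputSymbol :=
  .while (fun t => t marks = some (.bit true)) roundProg

/-- The last level `R'` is about to be erased, so only its size matters. A failed round merely sets
`bad`; the remaining rounds still run and keep the marks intact. -/
theorem roundsProg_takes {N : ℕ} {bs : List Bool} {bls : List (List (List Bool))}
    (C R : List (List Bool)) (k j : ℕ) (f : Bool)
    (s : Stk → List InputSymbol) (h : TestData N bs bls s) (h' : LevelData N R s)
    (hC : CandData N C s) (hf : s bad = encodeFlag f)
    (hm : s marks = List.replicate k (.bit true) ++ List.replicate j (.bit false)) :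
    ∃ R' : List (List Bool), (encodeWords R').length ≤ N ∧
      Takes roundsProg s s⟦lev ↦ encodeWords R'⟧⟦marks ↦ List.replicate j (.bit false)⟧⟦marksRev ↦
        List.replicate k (.bit true) ++ s marksRev⟧⟦bad ↦
        encodeFlag (f || !levelsNonempty bs bls C k R)⟧ ((stepTime N + 4) * k + 1) := by
  unfold roundsProg
  induction k generalizing s R f with
  | zero =>
    refine ⟨R, h'.size_le, (Takes.while_false ?_).to ?_ (by simp)⟩
    · simp only [stackTops, hm]
      cases j <;> simp [List.replicate_succ]
    · funext k
      cases k <;> simp [hm, hf, h'.lev, levelsNonempty]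
  | succ k ih =>
    have h₁ : Takes (.ite (fun t => (t Stk.lev).isSome) (.act []) (setFlag bad)) s
        s⟦bad ↦ encodeFlag (f || R.isEmpty)⟧ 2 := by
      cases hR : R with
      | nil =>
        refine (Takes.ite_false ?_ (setFlag_takes bad f s hf)).to (by simp) le_rfl
        simp [stackTops, h'.lev, hR]
      | cons w R =>
        refine (Takes.ite_true ?_ (Takes.skip s)).to ?_ le_rfl
        · rw [stackTops, h'.lev, hR, encodeWords_cons]
          exact encodeWord_head_isSome w _
        · simp [← hf]
    have h₂ := h₁.seq ((stepProg_takes C R _ (h.update bad _ (by decide))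
      (h'.update bad _ (by decide)) (hC.update bad _ (by decide))).seq (Takes.act [.move marks marksRev] _))
    obtain ⟨R', hR', h₃⟩ := ih (nextLevel bs bls C R) (f || R.isEmpty)
      s⟦bad ↦ encodeFlag (f || R.isEmpty)⟧⟦lev ↦ encodeWords (nextLevel bs bls C R)⟧⟦marks ↦
        List.replicate k (.bit true) ++ List.replicate j (.bit false)⟧⟦marksRev ↦
        .bit true :: s marksRev⟧
      ((((h.update _ _ (by decide)).update _ _ (by decide)).update _ _ (by decide)).update _ _
        (by decide))
      (by constructor <;> simp [h'.levRev, h'.pat, h'.found, hC.nextLevel_size_le])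
      ((((hC.update _ _ (by decide)).update _ _ (by decide)).update _ _ (by decide)).update _ _
        (by decide)) (by simp) (by simp)
    refine ⟨R', hR', (Takes.while_true ?_ (h₂.to ?_ le_rfl) h₃).to ?_ ?_⟩
    · simp [stackTops, hm, List.replicate_succ]
    · simp [StackOp.runAll, StackOp.run, hm, List.replicate_succ]
    · have e : (f || R.isEmpty || !levelsNonempty bs bls C k (nextLevel bs bls C R)) =
          (f || !levelsNonempty bs bls C (k + 1) R) := by
        simp [levelsNonempty, Bool.or_assoc]
      rw [e]
      funext k
      cases k <;> simp [List.replicate_succ']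
    · ring_nf; omega

/-- Sets `bad` if there are not `k` nonempty levels, where `k` is the number of marks. -/
def checkProg : StackProg Stk InputSymbol :=
  .seq (rewind cand candRev) (.seq (moveCopyWhile (fun _ => true) candRev cand lev)
    (.seq roundsProg (.seq (rewind marksRev marks) (clear lev))))

/-- The time of `checkProg`. -/
def checkTime {R : Type*} [CommSemiring R] (N : R) : R := (stepTime N + 4) * N + 8 * N + 5

/-- The stacks hold the data for testing the selection `bs`, of length at most `N`. -/
structure CheckData (N k j : ℕ) (bs : List Bool) (bls : List (List (List Bool)))
    (C : List (List Bool)) (s : Stk → List InputSymbol) : Prop where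
  test : TestData N bs bls s
  level : LevelData N [] s
  cand : CandData N C s
  marks : s marks = List.replicate k (.bit true) ++ List.replicate j (.bit false)
  marksRev : s marksRev = []
  bad : s bad = []
  marks_le : k ≤ N

/-- The iteration starts from the level of all candidates, copied to `lev` while `cand` is restored.
Everything but `bad` is as before, ready for another selection. -/
theorem checkProg_takes {N k j : ℕ} {bs : List Bool} {bls : List (List (List Bool))}
    {C : List (List Bool)} (s : Stk → List InputSymbol) (h : CheckData N k j bs bls C s) :
    Takes checkProg s s⟦Stk.bad ↦ encodeFlag (!levelsNonempty bs bls C k C)⟧ (checkTime N) := by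
  have hC := h.cand
  have h₁ := (rewind_takes (x := cand) (y := candRev) (by decide) s).seq
    (moveCopyWhile_takes (c := fun _ => true) (x := candRev) (y := cand) (z := lev) (by decide)
      (by decide) (by decide) (r := []) rfl (encodeWords C).reverse (fun _ _ => rfl)
      _ (by simp [hC.cand, hC.candRev]))
  obtain ⟨R', hR', h₂⟩ := roundsProg_takes C C k j false s⟦lev ↦ encodeWords C⟧
    (h.test.update _ _ (by decide))
    (by constructor <;> simp [h.level.levRev, h.level.pat, h.level.found, hC.size_le])
    (hC.update _ _ (by decide)) (by simp [h.bad]) (by simp [h.marks])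
  obtain ⟨m, hm, hrun⟩ := h₁.to (s' := s⟦lev ↦ encodeWords C⟧) (by
    funext k
    cases k <;> simp [hC.cand, hC.candRev, h.level.lev]) le_rfl
  cases hrun with
  | seq ha hb =>
    obtain ⟨m', hm', hrun'⟩ := h₂.seq ((rewind_takes (x := marksRev) (y := marks) (by decide) _).seq
      (clear_takes lev _))
    refine Takes.to ⟨_, le_rfl, .seq ha (.seq hb hrun')⟩ ?_ ?_
    · funext k
      cases k <;> simp [h.marksRev, h.marks, h.level.lev]
    · have h₃ := hC.size_le
      have h₄ := h.marks_le
      have h₅ : (stepTime N + 4) * k ≤ (stepTime N + 4) * N := Nat.mul_le_mul_left _ h₄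
      simp [hC.cand, h.marksRev] at hm hm'
      unfold checkTime
      omega

end StackProg

/-! ### The enumeration of all selections of a given size -/

/-- The selections of `k` out of `n` voters, in the order in which the machine visits them, followed
by the bits `r`. -/
def selections : ℕ → ℕ → List Bool → List (List Bool)
  | 0, 0, r => [r]
  | 0, _ + 1, _ => []
  | n + 1, 0, r => selections n 0 (false :: r)
  | n + 1, k + 1, r => selections n (k + 1) (false :: r) ++ selections n k (true :: r)

/-- The selection `y` is visited immediately after `x`. -/
def IsNextSelection (x y : List Bool) : Prop :=
  ∃ a b r, x = List.replicate a false ++ List.replicate (b + 1) true ++ false :: r ∧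
    y = List.replicate b true ++ List.replicate (a + 1) false ++ true :: r

/-- Pascal's rule; this is the only source of the non-polynomial factor in the running time. -/
theorem length_selections (n k : ℕ) (r : List Bool) : (selections n k r).length = n.choose k := by
  induction n generalizing k r with
  | zero => cases k <;> simp [selections]
  | succ n ih =>
    cases k with
    | zero => simp [selections, ih]
    | succ k => simp [selections, ih, Nat.choose_succ_succ, add_comm]

theorem mem_selections {n k : ℕ} {r x : List Bool} :
    x ∈ selections n k r ↔ ∃ w, w.length = n ∧ w.count true = k ∧ x = w ++ r := by
  induction n generalizing k r with
  | zero =>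
    cases k with
    | zero => simp [selections]
    | succ k => simp [selections]
  | succ n ih =>
    -- The recursion fixes the bit next to `r` first, so `w` is split at its last bit.
    have key : (∃ w : List Bool, w.length = n + 1 ∧ w.count true = k ∧ x = w ++ r) ↔
        ∃ w : List Bool, w.length = n ∧ ((w.count true = k ∧ x = w ++ false :: r) ∨
          (w.count true + 1 = k ∧ x = w ++ true :: r)) := by
      constructor
      · rintro ⟨w, h₁, h₂, rfl⟩
        rcases List.eq_nil_or_concat w with rfl | ⟨w, b, rfl⟩
        · simp at h₁
        · refine ⟨w, by simpa using h₁, ?_⟩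
          cases b <;> simp_all
      · rintro ⟨w, h₁, ⟨h₂, rfl⟩ | ⟨h₂, rfl⟩⟩
        · exact ⟨w ++ [false], by simp [h₁], by simp [h₂], by simp⟩
        · exact ⟨w ++ [true], by simp [h₁], by simp [h₂], by simp⟩
    rw [key]
    cases k with
    | zero => simp [selections, ih]
    | succ k =>
      simp only [selections, List.mem_append, ih, Nat.add_right_cancel_iff]
      constructor
      · rintro (⟨w, h₁, h₂, h₃⟩ | ⟨w, h₁, h₂, h₃⟩)
        · exact ⟨w, h₁, Or.inl ⟨h₂, h₃⟩⟩
        · exact ⟨w, h₁, Or.inr ⟨h₂, h₃⟩⟩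
      · rintro ⟨w, h₁, ⟨h₂, h₃⟩ | ⟨h₂, h₃⟩⟩
        · exact Or.inl ⟨w, h₁, h₂, h₃⟩
        · exact Or.inr ⟨w, h₁, h₂, h₃⟩

theorem selections_eq_nil {n k : ℕ} (h : n < k) (r : List Bool) : selections n k r = [] := by
  rw [← List.length_eq_zero_iff, length_selections, Nat.choose_eq_zero_of_lt h]

theorem head?_selections {n k : ℕ} (h : k ≤ n) (r : List Bool) : (selections n k r).head? =
    some (List.replicate k true ++ List.replicate (n - k) false ++ r) := by
  induction n generalizing k r with
  | zero =>
    obtain rfl : k = 0 := by omega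
    rfl
  | succ n ih =>
    cases k with
    | zero =>
      rw [selections, ih (Nat.zero_le n)]
      simp [List.replicate_succ']
    | succ k =>
      rw [selections]
      rcases Nat.lt_or_ge n (k + 1) with hk | hk
      · obtain rfl : n = k := by omega
        rw [selections_eq_nil hk, List.nil_append, ih le_rfl]
        simp [List.replicate_succ']
      · rw [List.head?_append, ih hk]
        have e : n + 1 - (k + 1) = (n - (k + 1)) + 1 := by omega
        simp [e, List.replicate_succ']

theorem getLast?_selections {n k : ℕ} (h : k ≤ n) (r : List Bool) : (selections n k r).getLast? =
    some (List.replicate (n - k) false ++ List.replicate k true ++ r) := by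
  induction n generalizing k r with
  | zero =>
    obtain rfl : k = 0 := by omega
    rfl
  | succ n ih =>
    cases k with
    | zero =>
      rw [selections, ih (Nat.zero_le n)]
      simp [List.replicate_succ']
    | succ k =>
      rw [selections, List.getLast?_append, ih (Nat.le_of_succ_le_succ h)]
      simp [List.replicate_succ']

/-- Within each half of the recursion this is the induction hypothesis; what remains is the
junction, described by `getLast?_selections` and `head?_selections`. -/
theorem isChain_selections (n k : ℕ) (r : List Bool) :
    (selections n k r).IsChain IsNextSelection := by
  induction n generalizing k r with
  | zero => cases k <;> simp [selections]
  | succ n ih =>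
    cases k with
    | zero => exact ih 0 _
    | succ k =>
      rw [selections]
      rcases Nat.lt_or_ge n (k + 1) with hk | hk
      · rw [selections_eq_nil hk]
        exact ih k _
      · refine (ih _ _).append (ih _ _) ?_
        intro x hx y hy
        rw [getLast?_selections hk, Option.mem_some_iff] at hx
        rw [head?_selections (Nat.le_of_succ_le hk), Option.mem_some_iff] at hy
        have e : n - k = (n - (k + 1)) + 1 := by omega
        -- Writing `a = n - (k + 1)`, the junction goes from `0^a 1^(k+1) 0 r` to `1^k 0^(a+1) 1 r`.
        exact ⟨n - (k + 1), k, r, hx.symm, by rw [← hy, e]⟩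

/-! ### The search through all selections -/

namespace StackProg

open Stk

/-- Replaces the selection by the next one; answers `false` and stops if there is none. -/
def nextProg : StackProg Stk InputSymbol :=
  .seq (moveWhile (fun a => a = .bit false) sel zeros)
    (.seq (moveWhile (fun a => a = .bit true) sel ones)
      (.ite (fun t => (t sel).isNone) (.act [.push ans (.bit false), .drop go])
        (.seq (.act [.drop sel, .push sel (.bit true), .push sel (.bit false)])
          (.seq (rewind zeros sel) (.seq (.act [.drop ones]) (rewind ones sel))))))

/-- In `0^a 1^(b+1) 0 r` the first `0` after the block of ones becomes `1`, with one extra `0` in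
front of it. The `a` zeros go back next, then all but one of the ones, which gives `1^b 0^(a+1) 1
r`. -/
theorem nextProg_takes {x y : List Bool} (h : IsNextSelection x y) (s : Stk → List InputSymbol)
    (hs : s sel = x.map .bit) (hz : s zeros = []) (ho : s ones = []) :
    Takes nextProg s s⟦sel ↦ y.map .bit⟧ (4 * x.length + 8) := by
  obtain ⟨a, b, r, rfl, rfl⟩ := h
  refine ((moveWhile_takes (by decide) (r := List.replicate (b + 1) (.bit true) ++ .bit false ::
      r.map .bit) (by simp [List.replicate_succ]) (List.replicate a (.bit false)) ?_ s ?_).seq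
    ((moveWhile_takes (by decide) (r := .bit false :: r.map .bit) (by simp)
      (List.replicate (b + 1) (.bit true)) ?_ _ ?_).seq
    (Takes.ite_false ?_ ((Takes.act _ _).seq ((rewind_takes (by decide) _).seq
      ((Takes.act _ _).seq (rewind_takes (by decide) _))))))).to ?_ ?_
  · simp
  · simp [hs]
  · simp
  · simp
  · simp [stackTops]
  · funext k
    cases k <;> simp [StackOp.runAll, StackOp.run, hz, ho, List.replicate_succ']
  · simp [StackOp.runAll, StackOp.run, hz, ho]
    omega

/-- No `0` follows the ones, so `sel` runs empty; this is how the end of the enumeration is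
recognised. -/
theorem nextProg_takes_of_last (a b : ℕ) (s : Stk → List InputSymbol)
    (hs : s sel = List.replicate a (.bit false) ++ List.replicate b (.bit true))
    (hz : s zeros = []) (ho : s ones = []) :
    Takes nextProg s s⟦sel ↦ []⟧⟦zeros ↦ List.replicate a (.bit false)⟧⟦ones ↦
      List.replicate b (.bit true)⟧⟦ans ↦ .bit false :: s ans⟧⟦go ↦ (s go).tail⟧
      (4 * (a + b) + 8) := by
  refine ((moveWhile_takes (by decide) (r := List.replicate b (.bit true))
      (by cases b <;> simp [List.replicate_succ]) (List.replicate a (.bit false)) ?_ s hs).seq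
    ((moveWhile_takes (by decide) (r := []) (by simp)
      (List.replicate b (.bit true)) ?_ _ ?_).seq
    (Takes.ite_true ?_ (Takes.act _ _)))).to ?_ ?_
  · simp
  · simp
  · simp
  · simp [stackTops]
  · funext k
    cases k <;> simp [StackOp.runAll, StackOp.run, hz, ho]
  · simp
    omega

/-- Tests the selection; answers `true` and stops if it succeeds, and goes on to the next selection
otherwise. -/
def visitProg : StackProg Stk InputSymbol :=
  .seq checkProg (.ite (fun t => (t bad).isNone) (.act [.push ans (.bit true), .drop go])
    (.seq (.act [.drop bad]) nextProg))

/-- Visits all selections. -/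
def searchProg : StackProg Stk InputSymbol := .while (fun t => (t go).isSome) visitProg

/-- The time of `visitProg`. -/
def visitTime {R : Type*} [CommSemiring R] (N : R) : R := checkTime N + 4 * N + 10

theorem CheckData.select {N k j : ℕ} {bs : List Bool} {bls : List (List (List Bool))}
    {C : List (List Bool)} {s : Stk → List InputSymbol} (h : CheckData N k j bs bls C s)
    (y : List Bool) (hy : y.length = bls.length) :
    CheckData N k j y bls C s⟦sel ↦ y.map .bit⟧ := by
  have ht := h.test
  refine ⟨⟨hy, ?_, ht.size_le, ?_, ?_, ?_, ?_, ?_, ?_, ?_⟩, h.level.update _ _ (by decide),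
    h.cand.update _ _ (by decide), ?_, ?_, ?_, h.marks_le⟩
  · rw [hy, ← ht.length_eq]; exact ht.length_le
  all_goals simp [ht.selRev, ht.bal, ht.balRev, ht.patRev, ht.tmp, ht.fail, h.marks, h.marksRev,
    h.bad]

section Visit

variable {N k j : ℕ} {x : List Bool} {bls : List (List (List Bool))} {C : List (List Bool)}
  {s : Stk → List InputSymbol}

theorem visitProg_takes_of_success (h : CheckData N k j x bls C s)
    (hx : levelsNonempty x bls C k C = true) :
    Takes visitProg s s⟦ans ↦ .bit true :: s ans⟧⟦go ↦ (s go).tail⟧ (visitTime N) := by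
  have hc := checkProg_takes s h
  rw [hx] at hc
  refine (hc.seq (Takes.ite_true ?_ (Takes.act _ _))).to ?_ ?_
  · simp [stackTops]
  · funext k
    cases k <;> simp [StackOp.runAll, StackOp.run, h.bad]
  · unfold visitTime; omega

theorem visitProg_takes_of_next (h : CheckData N k j x bls C s)
    (hx : levelsNonempty x bls C k C = false) {y : List Bool} (hxy : IsNextSelection x y)
    (hz : s zeros = []) (ho : s ones = []) :
    Takes visitProg s s⟦sel ↦ y.map .bit⟧ (visitTime N) := by
  have hc := checkProg_takes s h
  rw [hx] at hc
  refine (hc.seq (Takes.ite_false ?_ ((Takes.act _ _).seq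
    (nextProg_takes hxy _ ?_ ?_ ?_)))).to ?_ ?_
  · simp [stackTops]
  · simp [StackOp.runAll, StackOp.run, h.test.sel]
  · simp [StackOp.runAll, StackOp.run, hz]
  · simp [StackOp.runAll, StackOp.run, ho]
  · funext k
    cases k <;> simp [StackOp.runAll, StackOp.run, h.bad]
  · have := h.test.length_le
    unfold visitTime; omega

theorem visitProg_takes_of_last (h : CheckData N k j x bls C s)
    (hx : levelsNonempty x bls C k C = false) {a b : ℕ}
    (hab : x = List.replicate a false ++ List.replicate b true)
    (hz : s zeros = []) (ho : s ones = []) :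
    Takes visitProg s s⟦sel ↦ []⟧⟦zeros ↦ List.replicate a (.bit false)⟧⟦ones ↦
      List.replicate b (.bit true)⟧⟦ans ↦ .bit false :: s ans⟧⟦go ↦ (s go).tail⟧
      (visitTime N) := by
  have hc := checkProg_takes s h
  rw [hx] at hc
  refine (hc.seq (Takes.ite_false ?_ ((Takes.act _ _).seq
    (nextProg_takes_of_last a b _ ?_ ?_ ?_)))).to ?_ ?_
  · simp [stackTops]
  · simp [StackOp.runAll, StackOp.run, h.test.sel, hab]
  · simp [StackOp.runAll, StackOp.run, hz]
  · simp [StackOp.runAll, StackOp.run, ho]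
  · funext k
    cases k <;> simp [StackOp.runAll, StackOp.run, h.bad]
  · have := h.test.length_le
    have : x.length = a + b := by simp [hab]
    unfold visitTime; omega

end Visit

theorem length_update_le {K A : Type} [DecidableEq K] {N : ℕ} {s : K → List A}
    (h : ∀ i, (s i).length ≤ N) (k : K) {l : List A} (hl : l.length ≤ N) (i : K) :
    (s⟦k ↦ l⟧ i).length ≤ N := by
  rw [Function.update_apply]
  split_ifs
  exacts [hl, h i]

/-- The final stacks depend on where the search stops. They are described only by the answer and a
common size bound, which is enough to empty them in bounded time. -/
theorem searchProg_takes {N k j : ℕ} {bls : List (List (List Bool))} {C : List (List Bool)}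
    (L : List (List Bool)) (x : List Bool) (s : Stk → List InputSymbol)
    (h : CheckData N k j x bls C s) (hL : (x :: L).IsChain IsNextSelection)
    (hlen : ∀ y ∈ L, y.length = bls.length)
    (hlast : ∃ a b, (x :: L).getLast? = some (List.replicate a false ++ List.replicate b true))
    (hz : s zeros = []) (ho : s ones = []) (hg : s go = [.endList]) (hN : ∀ i, (s i).length ≤ N)
    (ha : s ans = []) :
    ∃ s', (∀ i, (s' i).length ≤ N) ∧
      s' ans = [.bit ((x :: L).any fun y => levelsNonempty y bls C k C)] ∧
      Takes searchProg s s' ((visitTime N + 1) * (L.length + 1) + 1) := by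
  unfold searchProg
  have hN1 : 1 ≤ N := by simpa [hg] using hN go
  have hgo : (fun t : Stk → Option InputSymbol => (t go).isSome) (stackTops s) = true := by
    simp [stackTops, hg]
  have hend : ∀ s' : Stk → List InputSymbol, s' go = [] →
      (fun t : Stk → Option InputSymbol => (t go).isSome) (stackTops s') = false := by
    intro s' hs'
    simp [stackTops, hs']
  induction L generalizing x s with
  | nil =>
    cases hx : levelsNonempty x bls C k C with
    | true =>
      refine ⟨_, ?_, ?_, (Takes.while_true hgo (visitProg_takes_of_success h hx)
        (Takes.while_false (hend _ ?_))).to rfl ?_⟩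
      · exact length_update_le (length_update_le hN _ (by simp [ha, hN1])) _ (by simp [hg])
      · simp [ha, hx]
      · simp [hg]
      · simp
    | false =>
      obtain ⟨a, b, hab⟩ := hlast
      simp only [List.getLast?_singleton, Option.some.injEq] at hab
      have hlab : x.length = a + b := by simp [hab]
      have hxN := h.test.length_le
      refine ⟨_, ?_, ?_, (Takes.while_true hgo (visitProg_takes_of_last h hx hab hz ho)
        (Takes.while_false (hend _ ?_))).to rfl ?_⟩
      · exact length_update_le (length_update_le (length_update_le (length_update_le
          (length_update_le hN _ (by simp)) _ (by simp; omega)) _ (by simp; omega)) _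
          (by simp [ha, hN1])) _ (by simp [hg])
      · simp [ha, hx]
      · simp [hg]
      · simp
  | cons y L ih =>
    cases hx : levelsNonempty x bls C k C with
    | true =>
      refine ⟨_, ?_, ?_, (Takes.while_true hgo (visitProg_takes_of_success h hx)
        (Takes.while_false (hend _ ?_))).to rfl ?_⟩
      · exact length_update_le (length_update_le hN _ (by simp [ha, hN1])) _ (by simp [hg])
      · simp [ha, hx]
      · simp [hg]
      · simp only [List.length_cons]
        ring_nf; omega
    | false =>
      have hsel := h.select y (hlen y (by simp))
      have hyN := hsel.test.length_le
      obtain ⟨s', h₁, h₂, h₃⟩ := ih y s⟦sel ↦ y.map .bit⟧ hsel (List.isChain_cons_cons.1 hL).2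
        (fun z hz => hlen z (by simp [hz])) (by simpa using hlast) (by simp [hz]) (by simp [ho])
        (by simp [hg]) (length_update_le hN _ (by simpa using hyN))
        (by simp [ha]) (by simp [stackTops, hg])
      refine ⟨s', h₁, ?_, (Takes.while_true hgo (visitProg_takes_of_next h hx
        (List.isChain_cons_cons.1 hL).1 hz ho) h₃).to rfl ?_⟩
      · rw [h₂, List.any_cons (a := x), hx, Bool.false_or]
      · simp only [List.length_cons]
        ring_nf; omega

end StackProg

theorem length_le_length_encodeTable (l : List (List (List Bool))) :
    l.length ≤ (encodeTable l).length := by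
  induction l with
  | nil => simp
  | cons w l ih => simp; omega

theorem endList_notMem_encodeWords (l : List (List Bool)) :
    InputSymbol.endList ∉ encodeWords l := by
  simp [encodeWords, encodeWord]

theorem encodeWords_eq_flatMap (l : List (List Bool)) :
    encodeWords l = (l.map (·.map .bit)).flatMap fun u => u ++ [.endNumber] := by
  simp [encodeWords, List.flatMap_map]; rfl

theorem encodeTable_eq_flatMap (l : List (List (List Bool))) :
    encodeTable l = (l.map encodeWords).flatMap fun u => u ++ [.endList] := by
  simp [encodeTable, List.flatMap_map]

/-! ### The program for Hidden-ID -/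

namespace StackProg

open Stk

/-- Reads a number from the input. -/
def readNumber (x : Stk) : StackProg Stk InputSymbol :=
  .seq (moveWhile InputSymbol.isBit inp tmp) (.seq (.act [.drop inp]) (rewind tmp x))

theorem readNumber_takes {x : Stk} (hd : [x, inp, tmp].Nodup) (w : List Bool)
    (r : List InputSymbol) (s : Stk → List InputSymbol) (hs : s inp = encodeWord w ++ r)
    (ht : s tmp = []) :
    Takes (readNumber x) s s⟦inp ↦ r⟧⟦x ↦ w.map .bit ++ s x⟧ (4 * w.length + 3) := by
  simp only [List.nodup_cons, List.mem_cons, not_or, List.not_mem_nil, not_false_eq_true,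
    and_true, List.nodup_nil] at hd
  obtain ⟨⟨hxi, hxt⟩, -⟩ := hd
  refine ((moveWhile_takes (by decide) (r := .endNumber :: r) rfl (w.map .bit) ?_ s ?_).seq
    ((Takes.act _ _).seq (rewind_takes (Ne.symm hxt) _))).to ?_ ?_
  · exact fun a => InputSymbol.isBit_of_mem_map
  · simp [hs, encodeWord]
  · simp only [StackOp.runAll, StackOp.run]
    funext k
    simp only [Function.update_apply]
    split_ifs <;> simp_all
  · simp [StackOp.runAll, StackOp.run, ht]; omega

/-- Reads the candidates; afterwards `marks` holds the minimum of the number on `num₁` and the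
number of candidates in unary, and `num₁` their difference. -/
def readCandidates : StackProg Stk InputSymbol :=
  .seq (readBlocks (fun a => a = some .endList) .endNumber inp candRev num₁ tmp marksRev)
    (.seq (.act [.drop inp]) (.seq (rewind candRev cand) (rewind marksRev marks)))

/-- Reads the ballots, and prepares the first selection in the same way. -/
def readBallots : StackProg Stk InputSymbol :=
  .seq (readBlocks (fun a => a = none) .endList inp balRev num₂ tmp selRev)
    (.seq (rewind balRev bal) (rewind selRev sel))

theorem readCandidates_takes {N : ℕ} (C : List (List Bool)) (q : List Bool)
    (r : List InputSymbol) (s : Stk → List InputSymbol)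
    (hs : s inp = encodeWords C ++ .endList :: r) (hq : s num₁ = q.map .bit) (ht : s tmp = [])
    (hC : s cand = []) (hC' : s candRev = []) (hm : s marks = []) (hm' : s marksRev = [])
    (hN : (encodeWords C).length ≤ N) (hqN : q.length ≤ N) :
    ∃ q' : List Bool, q'.length = q.length ∧ wordValue q' = wordValue q - C.length ∧
      Takes readCandidates s s⟦inp ↦ r⟧⟦cand ↦ encodeWords C⟧⟦num₁ ↦ q'.map .bit⟧⟦marks ↦
        (unaryBits C.length (wordValue q)).map .bit⟧ ((4 * N + 7) * N + 6 * N + 4) := by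
  rw [encodeWords_eq_flatMap] at hs
  obtain ⟨q', h₁, h₂, h₃⟩ := readBlocks_takes (halts := fun a => a = some .endList)
    (sep := .endNumber) (inp := inp) (dst := candRev) (x := num₁) (t := tmp) (y := marksRev)
    (by decide) (r := .endList :: r) (by simp) (C.map (·.map .bit)) (by simp)
    (by
      intro u hu
      obtain ⟨w, _, rfl⟩ := List.mem_map.1 hu
      cases w <;> simp) q s hs hq ht
  rw [← encodeWords_eq_flatMap] at h₃
  simp only [List.length_map] at h₂ h₃
  refine ⟨q', h₁, h₂, (h₃.seq ((Takes.act _ _).seq ((rewind_takes (by decide) _).seq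
    (rewind_takes (by decide) _)))).to ?_ ?_⟩
  · funext k
    cases k <;> simp [StackOp.runAll, StackOp.run, hC, hC', hm, hm']
  · have h₄ : C.length ≤ N := (length_le_length_encodeWords C).trans hN
    have h₅ : (4 * q.length + 7) * C.length ≤ (4 * N + 7) * N :=
      Nat.mul_le_mul (by omega) h₄
    simp [StackOp.runAll, StackOp.run, hC', hm', length_unaryBits]
    omega

theorem readBallots_takes {N : ℕ} (bls : List (List (List Bool))) (q : List Bool)
    (s : Stk → List InputSymbol)
    (hs : s inp = encodeTable bls) (hq : s num₂ = q.map .bit) (ht : s tmp = [])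
    (hb : s bal = []) (hb' : s balRev = []) (hm : s sel = []) (hm' : s selRev = [])
    (hN : (encodeTable bls).length ≤ N) (hqN : q.length ≤ N) :
    ∃ q' : List Bool, q'.length = q.length ∧ wordValue q' = wordValue q - bls.length ∧
      Takes readBallots s s⟦inp ↦ []⟧⟦bal ↦ encodeTable bls⟧⟦num₂ ↦ q'.map .bit⟧⟦sel ↦
        (unaryBits bls.length (wordValue q)).map .bit⟧ ((4 * N + 7) * N + 6 * N + 4) := by
  rw [encodeTable_eq_flatMap, ← List.append_nil (List.flatMap _ _)] at hs
  obtain ⟨q', h₁, h₂, h₃⟩ := readBlocks_takes (halts := fun a => a = none)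
    (sep := .endList) (inp := inp) (dst := balRev) (x := num₂) (t := tmp) (y := selRev)
    (by decide) (r := []) (by simp) (bls.map encodeWords)
    (by
      intro u hu
      obtain ⟨w, _, rfl⟩ := List.mem_map.1 hu
      exact endList_notMem_encodeWords w)
    (by simp) q s hs hq ht
  rw [← encodeTable_eq_flatMap] at h₃
  simp only [List.length_map] at h₂ h₃
  refine ⟨q', h₁, h₂, (h₃.seq ((rewind_takes (by decide) _).seq
    (rewind_takes (by decide) _))).to ?_ ?_⟩
  · funext k
    cases k <;> simp [hb, hb', hm, hm']
  · have h₄ : bls.length ≤ N := (length_le_length_encodeTable bls).trans hN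
    have h₅ : (4 * q.length + 7) * bls.length ≤ (4 * N + 7) * N :=
      Nat.mul_le_mul (by omega) h₄
    simp [hb', hm', length_unaryBits]
    omega

/-- Drops leading zeros, so that the number `0` becomes empty. -/
def dropZeros (x : Stk) : StackProg Stk InputSymbol := dropWhile (fun a => a = .bit false) x

/-- Afterwards a test for zero is a test for an empty stack, which a condition on top symbols can
express. -/
theorem dropZeros_takes (x : Stk) (q : List Bool) (s : Stk → List InputSymbol)
    (hs : s x = q.map .bit) :
    ∃ l : List InputSymbol, l.length ≤ q.length ∧ (l = [] ↔ wordValue q = 0) ∧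
      Takes (dropZeros x) s s⟦x ↦ l⟧ (2 * q.length + 1) := by
  rcases exists_leading_false q with ⟨i, rfl⟩ | ⟨i, r, rfl⟩
  · exact ⟨[], by simp, by simp [wordValue_replicate_false],
      (dropWhile_takes rfl (List.replicate i (.bit false)) (by simp) s (by simp [hs])).to rfl
        (by simp)⟩
  · exact ⟨.bit true :: r.map .bit, by simp, by simp [wordValue_borrow],
      (dropWhile_takes (by simp) (List.replicate i (.bit false)) (by simp) s (by simp [hs])).to rfl
        (by simp)⟩

/-- Reads the input and prepares the stacks for the search. -/
def setupProg : StackProg Stk InputSymbol :=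
  .seq (readNumber num₁) (.seq (readNumber num₂) (.seq readCandidates (.seq readBallots
    (.seq (dropZeros num₁) (.seq (dropZeros num₂) (.act [.push pat .endList, .push go .endList]))))))

/-- The stacks at the beginning of the search. -/
def searchStacks (l₁ l₂ : List InputSymbol) (m n : ℕ) (C : List (List Bool))
    (bls : List (List (List Bool))) : Stk → List InputSymbol
  | num₁ => l₁
  | num₂ => l₂
  | cand => encodeWords C
  | bal => encodeTable bls
  | marks => (unaryBits C.length m).map .bit
  | sel => (unaryBits bls.length n).map .bit
  | pat => [.endList]
  | go => [.endList]
  | _ => []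

/-- The time of `setupProg`. -/
def setupTime {R : Type*} [CommSemiring R] (N : R) : R := 2 * ((4 * N + 7) * N) + 24 * N + 17

theorem setupProg_takes {N : ℕ} (w₁ w₂ : List Bool) (C : List (List Bool))
    (bls : List (List (List Bool)))
    (hN : (encodeWord w₁ ++ encodeWord w₂ ++ encodeWords C ++ .endList :: encodeTable bls).length
      ≤ N) :
    ∃ l₁ l₂ : List InputSymbol, l₁.length ≤ N ∧ l₂.length ≤ N ∧
      (l₁ = [] ↔ wordValue w₁ ≤ C.length) ∧ (l₂ = [] ↔ wordValue w₂ ≤ bls.length) ∧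
      Takes setupProg (Function.update (fun _ => []) inp
          (encodeWord w₁ ++ encodeWord w₂ ++ encodeWords C ++ .endList :: encodeTable bls))
        (searchStacks l₁ l₂ (wordValue w₁) (wordValue w₂) C bls) (setupTime N) := by
  simp only [List.length_append, length_encodeWord, List.length_cons] at hN
  have h₁ := readNumber_takes (x := num₁) (by decide) w₁
    (encodeWord w₂ ++ (encodeWords C ++ .endList :: encodeTable bls))
    (Function.update (fun _ => []) inp
      (encodeWord w₁ ++ encodeWord w₂ ++ encodeWords C ++ .endList :: encodeTable bls))
    (by simp) (by simp)
  have h₂ := readNumber_takes (x := num₂) (by decide) w₂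
    (encodeWords C ++ .endList :: encodeTable bls) (Function.update (fun _ => []) inp
      (encodeWord w₂ ++ (encodeWords C ++ .endList :: encodeTable bls)))⟦num₁ ↦ w₁.map .bit⟧
    (by simp) (by simp)
  obtain ⟨q₁, hq₁, hv₁, h₃⟩ := readCandidates_takes (N := N) C w₁ (encodeTable bls)
    (Function.update (fun _ => []) inp (encodeWords C ++ .endList :: encodeTable bls))⟦num₁ ↦
      w₁.map .bit⟧⟦num₂ ↦ w₂.map .bit⟧
    (by simp) (by simp) (by simp) (by simp) (by simp) (by simp) (by simp) (by omega) (by omega)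
  obtain ⟨q₂, hq₂, hv₂, h₄⟩ := readBallots_takes (N := N) bls w₂
    (Function.update (fun _ => []) inp (encodeTable bls))⟦num₁ ↦
      q₁.map .bit⟧⟦num₂ ↦ w₂.map .bit⟧⟦cand ↦ encodeWords C⟧⟦marks ↦
        (unaryBits C.length (wordValue w₁)).map .bit⟧
    (by simp) (by simp) (by simp) (by simp) (by simp) (by simp) (by simp) (by omega) (by omega)
  obtain ⟨l₁, hl₁, hv₃, h₅⟩ := dropZeros_takes num₁ q₁ (fun _ => [])⟦num₁ ↦
      q₁.map .bit⟧⟦num₂ ↦ q₂.map .bit⟧⟦cand ↦ encodeWords C⟧⟦marks ↦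
        (unaryBits C.length (wordValue w₁)).map .bit⟧⟦bal ↦ encodeTable bls⟧⟦sel ↦
        (unaryBits bls.length (wordValue w₂)).map .bit⟧ (by simp)
  obtain ⟨l₂, hl₂, hv₄, h₆⟩ := dropZeros_takes num₂ q₂ (fun _ => [])⟦num₁ ↦
      l₁⟧⟦num₂ ↦ q₂.map .bit⟧⟦cand ↦ encodeWords C⟧⟦marks ↦
        (unaryBits C.length (wordValue w₁)).map .bit⟧⟦bal ↦ encodeTable bls⟧⟦sel ↦
        (unaryBits bls.length (wordValue w₂)).map .bit⟧ (by simp)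
  refine ⟨l₁, l₂, by omega, by omega, by rw [hv₃]; omega, by rw [hv₄]; omega,
    ((h₁.to ?_ le_rfl).seq ((h₂.to ?_ le_rfl).seq ((h₃.to ?_ le_rfl).seq ((h₄.to ?_ le_rfl).seq
      ((h₅.to ?_ le_rfl).seq (h₆.seq (Takes.act _ _))))))).to ?_ ?_⟩
  iterate 5
    · funext k
      cases k <;> simp
  · funext k
    cases k <;> simp [StackOp.runAll, StackOp.run, searchStacks]
  · unfold setupTime
    omega

/-- The program for Hidden-ID. -/
def mainProg : StackProg Stk InputSymbol :=
  .seq setupProg (.seq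
    (.ite (fun t => (t num₁).isSome || (t num₂).isSome) (.act [.push ans (.bit false)]) searchProg)
    (clearAll [inp, num₁, num₂, tmp, marks, marksRev, sel, selRev, cand, candRev, bal, balRev,
      lev, levRev, new, pat, patRev, fail, found, bad, zeros, ones, go]))

theorem searchStacks_length_le {N : ℕ} {l₁ l₂ : List InputSymbol} {m n : ℕ}
    {C : List (List Bool)} {bls : List (List (List Bool))} (h₁ : l₁.length ≤ N)
    (h₂ : l₂.length ≤ N) (hC : (encodeWords C).length ≤ N) (hb : (encodeTable bls).length ≤ N)
    (hN : 1 ≤ N) (i : Stk) : (searchStacks l₁ l₂ m n C bls i).length ≤ N := by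
  have := length_le_length_encodeWords C
  have := length_le_length_encodeTable bls
  cases i <;> simp [searchStacks, length_unaryBits] <;> omega

theorem searchProg_takes_of_le {N : ℕ} {l₁ l₂ : List InputSymbol} {m n : ℕ}
    {C : List (List Bool)} {bls : List (List (List Bool))} (h₁ : l₁.length ≤ N)
    (h₂ : l₂.length ≤ N) (hC : (encodeWords C).length ≤ N) (hb : (encodeTable bls).length ≤ N)
    (hN : 1 ≤ N) (hm : m ≤ C.length) (hn : n ≤ bls.length) :
    ∃ s', (∀ i, (s' i).length ≤ N) ∧
      s' ans = [.bit ((selections bls.length n []).any fun y => levelsNonempty y bls C m C)] ∧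
      Takes searchProg (searchStacks l₁ l₂ m n C bls) s'
        ((visitTime N + 1) * (bls.length.choose n) + 1) := by
  have hCN := length_le_length_encodeWords C
  have hbN := length_le_length_encodeTable bls
  have hhead := head?_selections hn []
  have hlast := getLast?_selections hn []
  have hchain := isChain_selections bls.length n []
  have hlen : ∀ y ∈ selections bls.length n [], y.length = bls.length := by
    intro y hy
    obtain ⟨w, hw, _, rfl⟩ := mem_selections.1 hy
    simpa using hw
  have hcard := length_selections bls.length n []
  rw [← hcard]
  generalize selections bls.length n [] = L at *
  cases L with
  | nil => simp at hhead
  | cons x L =>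
    -- The unary copy of `n'` that was produced while reading the ballots is already the first
    -- selection.
    rw [List.head?_cons, Option.some.injEq, List.append_nil, ← unaryBits_eq hn] at hhead
    have hdata : CheckData N m (C.length - m) x bls C (searchStacks l₁ l₂ m n C bls) := by
      refine ⟨⟨hlen x (by simp), ?_, hb, ?_, rfl, rfl, rfl, rfl, rfl, rfl⟩,
        ⟨rfl, rfl, rfl, rfl, by simp⟩, ⟨rfl, rfl, rfl, hC⟩, ?_, rfl, rfl, by omega⟩
      · rw [hlen x (by simp)]; omega
      · rw [hhead]; rfl
      · simp [searchStacks, unaryBits_eq hm]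
    obtain ⟨s', ha, hb', hc⟩ := searchProg_takes L x _ hdata hchain
      (fun y hy => hlen y (by simp [hy])) ⟨_, _, by rw [hlast, List.append_nil]⟩ rfl rfl rfl
      (searchStacks_length_le h₁ h₂ hC hb hN) rfl
    exact ⟨s', ha, hb', hc⟩

/-- A polynomial factor of the time of `mainProg`. -/
def mainTime {R : Type*} [CommSemiring R] (N : R) : R := visitTime N + setupTime N + 46 * N + 28

theorem mainProg_takes {N : ℕ} (w₁ w₂ : List Bool) (C : List (List Bool))
    (bls : List (List (List Bool)))
    (hN : (encodeWord w₁ ++ encodeWord w₂ ++ encodeWords C ++ .endList :: encodeTable bls).length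
      ≤ N) :
    Takes mainProg (Function.update (fun _ => []) inp
        (encodeWord w₁ ++ encodeWord w₂ ++ encodeWords C ++ .endList :: encodeTable bls))
      (Function.update (fun _ => []) ans [.bit (decide (wordValue w₁ ≤ C.length ∧
        wordValue w₂ ≤ bls.length ∧ ∃ y ∈ selections bls.length (wordValue w₂) [],
          levelsNonempty y bls C (wordValue w₁) C = true))])
      ((bls.length.choose (wordValue w₂) + 1) * mainTime N) := by
  obtain ⟨l₁, l₂, hl₁, hl₂, he₁, he₂, hsetup⟩ := setupProg_takes w₁ w₂ C bls hN
  simp only [List.length_append, length_encodeWord, List.length_cons] at hN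
  have key : ∃ s', (∀ i, (s' i).length ≤ N) ∧ s' ans = [.bit (decide (wordValue w₁ ≤ C.length ∧
        wordValue w₂ ≤ bls.length ∧ ∃ y ∈ selections bls.length (wordValue w₂) [],
          levelsNonempty y bls C (wordValue w₁) C = true))] ∧
      Takes (.ite (fun t => (t num₁).isSome || (t num₂).isSome) (.act [.push ans (.bit false)])
        searchProg) (searchStacks l₁ l₂ (wordValue w₁) (wordValue w₂) C bls) s'
        ((visitTime N + 1) * (bls.length.choose (wordValue w₂)) + 2) := by
    by_cases hle : wordValue w₁ ≤ C.length ∧ wordValue w₂ ≤ bls.length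
    · obtain ⟨s', h₁, h₂, h₃⟩ := searchProg_takes_of_le hl₁ hl₂ (by omega) (by omega) (by omega)
        hle.1 hle.2
      refine ⟨s', h₁, ?_, (Takes.ite_false ?_ h₃).to rfl le_rfl⟩
      · rw [h₂]
        simp [hle]
        rw [Bool.eq_iff_iff]
        simp
      · simp [stackTops, searchStacks, he₁.2 hle.1, he₂.2 hle.2]
    · refine ⟨_, ?_, ?_, (Takes.ite_true ?_ (Takes.act _ _)).to rfl (by omega)⟩
      · exact length_update_le (searchStacks_length_le hl₁ hl₂ (by omega) (by omega) (by omega)) _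
          (by simp [searchStacks]; omega)
      · have : ¬ (wordValue w₁ ≤ C.length ∧ wordValue w₂ ≤ bls.length ∧
            ∃ y ∈ selections bls.length (wordValue w₂) [],
              levelsNonempty y bls C (wordValue w₁) C = true) := fun h => hle ⟨h.1, h.2.1⟩
        simp [StackOp.runAll, StackOp.run, searchStacks, this]
      · rw [← he₁, ← he₂, not_and_or] at hle
        simp only [stackTops, searchStacks, Bool.or_eq_true]
        refine hle.imp ?_ ?_
        · cases l₁ <;> simp
        · cases l₂ <;> simp
  obtain ⟨s', h₁, h₂, h₃⟩ := key
  refine (hsetup.seq (h₃.seq (clearAll_takes _ N s' fun x _ => h₁ x))).to ?_ ?_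
  · funext k
    cases k <;> simp [h₂]
  · simp only [mainTime, List.length_cons, List.length_nil]
    -- Setup and clearing happen once, but the bound charges them to every selection; the product is
    -- the surplus so created.
    nlinarith [Nat.zero_le (bls.length.choose (wordValue w₂) * (setupTime N + 46 * N + 27))]

end StackProg

/-! ### Correctness -/

theorem wordValue_encodePosNum (p : PosNum) : wordValue (Computability.encodePosNum p) = p := by
  induction p with
  | one => rfl
  | bit0 p ih => simp [Computability.encodePosNum, wordValue, ih, two_mul]
  | bit1 p ih => simp [Computability.encodePosNum, wordValue, ih]; ring

theorem wordValue_encodeNat (n : ℕ) : wordValue (Computability.encodeNat n) = n := by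
  have h : wordValue (Computability.encodeNum n) = ((n : Num) : ℕ) := by
    cases (n : Num) with
    | zero => rfl
    | pos p => exact wordValue_encodePosNum p
  rw [Computability.encodeNat, h, Num.to_of_nat]

theorem encodeNat_injective : Function.Injective Computability.encodeNat :=
  Function.LeftInverse.injective Computability.decode_encodeNat

/-- The name of a candidate. -/
def candidateWord {m : ℕ} (c : Fin m) : List Bool := Computability.encodeNat c

theorem candidateWord_injective {m : ℕ} : Function.Injective (candidateWord (m := m)) :=
  fun _ _ h => Fin.ext (encodeNat_injective h)

/-- The names of all candidates. -/
def candidateWords (m : ℕ) : List (List Bool) := (List.finRange m).map candidateWord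

/-- The ballots of all voters. -/
noncomputable def ballotWords {m n : ℕ} (E : Election (Fin m) (Fin n)) : List (List (List Bool)) :=
  (List.finRange n).map fun v => (E.ballot v).map candidateWord

theorem encodeCandidates_eq {m : ℕ} (l : List (Fin m)) :
    encodeCandidates l = encodeWords (l.map candidateWord) ++ [.endList] := by
  -- In `encodeCandidates` the coercion to `ℕ` is applied to the whole list as a monadic bind, which
  -- is identified here with a map.
  have h : (do let a ← l; pure (a : ℕ)) = List.map (fun a : Fin m => (a : ℕ)) l :=
    List.map_eq_flatMap.symm
  rw [encodeCandidates, h, encodeWords, List.flatMap_map, List.flatMap_map]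
  rfl

theorem encodeInstance_eq (I : HiddenIDInstance) : encodeInstance I =
    encodeWord (Computability.encodeNat I.m') ++ encodeWord (Computability.encodeNat I.n') ++
      encodeWords (candidateWords I.numCandidates) ++
        .endList :: encodeTable (ballotWords I.election) := by
  simp only [encodeInstance, encodeCandidates_eq, encodeTable, ballotWords, List.flatMap_map,
    candidateWords, List.append_assoc, List.singleton_append]
  rfl

/-! ### Identity subelections and dominance chains -/

namespace Election

variable {m n : ℕ} (E : Election (Fin m) (Fin n))

/-- A ballot is sorted by preference and lists every candidate. If `d` is preferred, then `c` cannot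
stand before `d` or coincide with it, so it stands after it. -/
theorem pair_sublist_ballot (v : Fin n) (c d : Fin m) :
    [d, c].Sublist (E.ballot v) ↔ E.pref v d c := by
  have := E.strictTotal v
  constructor
  · intro h
    simpa using (E.ballot_pairwise v).sublist h
  · intro h
    have hmem : ∀ x, x ∈ E.ballot v := fun x => (E.ballot_perm v).mem_iff.2 (List.mem_finRange x)
    obtain ⟨l₁, l₂, hl⟩ := List.append_of_mem (hmem d)
    have hp := E.ballot_pairwise v
    have hc := hmem c
    rw [hl] at hc hp ⊢
    rw [List.pairwise_append] at hp
    rcases List.mem_append.1 hc with hc | hc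
    · exact absurd (hp.2.2 c hc d (by simp)) (asymm_of (E.pref v) h)
    · rcases List.mem_cons.1 hc with rfl | hc
      · exact absurd h (irrefl_of (E.pref v) c)
      · exact ((List.singleton_sublist.2 hc).cons_cons d).trans (List.sublist_append_right _ _)

/-- All voters in `V'` prefer `d` to `c`. -/
def Dominates (V' : Finset (Fin n)) (d c : Fin m) : Prop := ∀ v ∈ V', E.pref v d c

/-- The selection bits of a set of voters. -/
def selectionBits (V' : Finset (Fin n)) : List Bool := (List.finRange n).map fun v => decide (v ∈ V')

theorem agree_selectionBits (V' : Finset (Fin n)) (c d : Fin m) :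
    agree (selectionBits V') (ballotWords E) [candidateWord d, candidateWord c] = true ↔
      E.Dominates V' d c := by
  have h : ∀ v, [candidateWord d, candidateWord c].Sublist ((E.ballot v).map candidateWord) ↔
      E.pref v d c := by
    intro v
    rw [← E.pair_sublist_ballot, List.sublist_map_iff]
    constructor
    · rintro ⟨l, hl, he⟩
      have : l = [d, c] := candidateWord_injective.list_map he.symm
      exact this ▸ hl
    · exact fun hl => ⟨_, hl, rfl⟩
  simp only [agree, selectionBits, ballotWords, List.zip_map', List.all_map, List.all_eq_true,
    Function.comp, List.mem_finRange, forall_const, Bool.or_eq_true, Bool.not_eq_true',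
    decide_eq_false_iff_not, List.isSublist_iff_sublist, h, Dominates]
  exact forall_congr' fun v => imp_iff_not_or.symm

theorem mem_nextLevel (V' : Finset (Fin n)) (R : List (Fin m)) (c : Fin m) :
    candidateWord c ∈ nextLevel (selectionBits V') (ballotWords E) (candidateWords m)
      (R.map candidateWord) ↔ ∃ d ∈ R, E.Dominates V' d c := by
  simp only [nextLevel, candidateWords, List.mem_filter, List.any_map, List.any_eq_true,
    Function.comp, E.agree_selectionBits]
  simp

theorem exists_nextLevel_eq (V' : Finset (Fin n)) (R : List (Fin m)) :
    ∃ R' : List (Fin m), nextLevel (selectionBits V') (ballotWords E) (candidateWords m)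
      (R.map candidateWord) = R'.map candidateWord := by
  rw [nextLevel, candidateWords, List.filter_map]
  exact ⟨_, rfl⟩

/-- The next level consists of the possible second elements of a chain that starts in `R`, so the
induction peels off the first element. No property of dominance as an order is used. -/
theorem levelsNonempty_iff (V' : Finset (Fin n)) (k : ℕ) (R : List (Fin m)) :
    levelsNonempty (selectionBits V') (ballotWords E) (candidateWords m) k
      (R.map candidateWord) = true ↔
      ∃ l : List (Fin m), l.length = k ∧ l.IsChain (E.Dominates V') ∧ ∀ x ∈ l.head?, x ∈ R := by
  induction k generalizing R with
  | zero =>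
    simp only [levelsNonempty, true_iff]
    exact ⟨[], rfl, by simp, by simp⟩
  | succ k ih =>
    obtain ⟨R', hR'⟩ := E.exists_nextLevel_eq V' R
    have hmem : ∀ c, c ∈ R' ↔ ∃ d ∈ R, E.Dominates V' d c := by
      intro c
      rw [← E.mem_nextLevel, hR', List.mem_map_of_injective candidateWord_injective]
    rw [levelsNonempty, hR', Bool.and_eq_true, ih]
    constructor
    · rintro ⟨hne, l, hl, hc, hh⟩
      cases l with
      | nil =>
        -- An empty tail only occurs for `k = 0`; then any member of `R` is the required chain.
        cases R with
        | nil => simp at hne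
        | cons x R => exact ⟨[x], by simpa using hl.symm, by simp, by simp⟩
      | cons y l =>
        obtain ⟨d, hd, hdy⟩ := (hmem y).1 (hh y rfl)
        refine ⟨d :: y :: l, by simpa using hl, List.isChain_cons_cons.2 ⟨hdy, hc⟩, ?_⟩
        rintro x ⟨⟩
        exact hd
    · rintro ⟨l, hl, hc, hh⟩
      cases l with
      | nil => simp at hl
      | cons d l =>
        have hd := hh d rfl
        refine ⟨by cases R <;> simp_all, l, by simpa using hl, hc.tail, ?_⟩
        intro x hx
        cases l with
        | nil => simp at hx
        | cons y l =>
          obtain rfl : y = x := by simpa using hx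
          exact (hmem y).2 ⟨d, hd, (List.isChain_cons_cons.1 hc).1⟩

theorem exists_mem_selections_iff (k : ℕ) (P : List Bool → Prop) :
    (∃ y ∈ selections n k [], P y) ↔ ∃ V' : Finset (Fin n), V'.card = k ∧ P (selectionBits V') := by
  have hcard : ∀ V' : Finset (Fin n), (selectionBits V').count true = V'.card := by
    intro V'
    have h : V' = ((List.finRange n).filter fun v => v ∈ V').toFinset := by
      ext v; simp
    conv_rhs => rw [h]
    rw [List.toFinset_card_of_nodup ((List.nodup_finRange n).filter _), selectionBits, List.count,
      List.countP_map, List.countP_eq_length_filter]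
    congr 1
    refine List.filter_congr fun v _ => ?_
    simp
  constructor
  · rintro ⟨y, hy, hP⟩
    obtain ⟨w, hw, hk, rfl⟩ := mem_selections.1 hy
    rw [List.append_nil] at hP
    have h : selectionBits (Finset.univ.filter fun v : Fin n => w[v] = true) = w := by
      refine List.ext_getElem (by simp [selectionBits, hw]) fun i h₁ h₂ => ?_
      simp [selectionBits]
    exact ⟨_, by rw [← hcard, h, hk], by rwa [h]⟩
  · rintro ⟨V', hV, hP⟩
    exact ⟨_, mem_selections.2 ⟨selectionBits V', by simp [selectionBits], by rw [hcard, hV],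
      by simp⟩, hP⟩

/-- The ballot of any one selected voter, restricted to `C'`, is a chain because the others agree
with it. If `V'` is empty, dominance is vacuous and any list of candidates will do. -/
theorem exists_chain_of_isIdentity (C' : Finset (Fin m)) (V' : Finset (Fin n))
    (h : (E.subelection C' V').IsIdentity) (k : ℕ) (hk : k ≤ C'.card) :
    ∃ l : List (Fin m), l.length = k ∧ l.IsChain (E.Dominates V') := by
  rcases V'.eq_empty_or_nonempty with rfl | ⟨v, hv⟩
  · have hkm : k ≤ m := hk.trans (by simpa using Finset.card_le_univ C')
    refine ⟨(List.finRange m).take k, by simpa using hkm, ?_⟩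
    have : E.Dominates ∅ = fun _ _ => True := by
      funext a b
      simp [Dominates]
    rw [this]
    exact (List.pairwise_of_forall fun _ _ => trivial).isChain
  · refine ⟨((E.ballot v).filter fun c => c ∈ C').take k, ?_, ?_⟩
    · have hnd : (E.ballot v).Nodup := (E.ballot_perm v).nodup_iff.2 (List.nodup_finRange m)
      have e : ((E.ballot v).filter fun c => c ∈ C').toFinset = C' := by
        ext c
        simp [(E.ballot_perm v).mem_iff]
      rw [List.length_take, ← List.toFinset_card_of_nodup (hnd.filter _), e, min_eq_left hk]
    · refine List.Pairwise.isChain ?_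
      have hp := ((E.ballot_pairwise v).filter fun c => decide (c ∈ C'))
      refine (List.Pairwise.imp_of_mem ?_ hp).sublist (List.take_sublist _ _)
      intro a b ha hb hab w hw
      have ha' : a ∈ C' := by simpa using (List.mem_filter.1 ha).2
      have hb' : b ∈ C' := by simpa using (List.mem_filter.1 hb).2
      have := congrFun (congrFun (h ⟨v, hv⟩ ⟨w, hw⟩) ⟨a, ha'⟩) ⟨b, hb'⟩
      exact this.mp hab

/-- For nonempty `V'` dominance is transitive and irreflexive, so the chain has no repetitions and
any two of its members are compared alike by all voters. For empty `V'` chains may repeat; `hm` then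
makes the set of all candidates large enough. -/
theorem exists_isIdentity_of_chain (V' : Finset (Fin n)) (l : List (Fin m))
    (hl : l.IsChain (E.Dominates V')) (hm : l.length ≤ m) :
    ∃ C' : Finset (Fin m), l.length ≤ C'.card ∧ (E.subelection C' V').IsIdentity := by
  rcases V'.eq_empty_or_nonempty with rfl | ⟨v, hv⟩
  · exact ⟨Finset.univ, by simpa using hm, fun v => absurd v.2 (Finset.notMem_empty _)⟩
  · have : IsTrans (Fin m) (E.Dominates V') := ⟨fun a b c hab hbc w hw =>
      have := E.strictTotal w
      trans_of (E.pref w) (hab w hw) (hbc w hw)⟩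
    have hp := List.isChain_iff_pairwise.1 hl
    have hnd : l.Nodup := hp.imp fun {a b} hab => by
      rintro rfl
      have := E.strictTotal v
      exact irrefl_of (E.pref v) a (hab v hv)
    refine ⟨l.toFinset, by rw [List.toFinset_card_of_nodup hnd], ?_⟩
    have htot : ∀ a ∈ l, ∀ b ∈ l, a = b ∨ E.Dominates V' a b ∨ E.Dominates V' b a := by
      intro a ha b hb
      exact List.Pairwise.forall_of_forall_of_flip (R := fun a b => a = b ∨ E.Dominates V' a b ∨
        E.Dominates V' b a) (fun _ _ => Or.inl rfl) (hp.imp fun h => Or.inr (Or.inl h))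
        (hp.imp fun h => Or.inr (Or.inr h)) ha hb
    have key : ∀ v ∈ V', ∀ w ∈ V', ∀ a ∈ l, ∀ b ∈ l, E.pref v a b → E.pref w a b := by
      intro v hv w hw a ha b hb hab
      have := E.strictTotal v
      rcases htot a ha b hb with rfl | h | h
      · exact absurd hab (irrefl_of (E.pref v) a)
      · exact h w hw
      · exact absurd (h v hv) (asymm_of (E.pref v) hab)
    rintro ⟨v, hv⟩ ⟨w, hw⟩
    funext ⟨a, ha⟩ ⟨b, hb⟩
    rw [List.mem_toFinset] at ha hb
    exact propext ⟨key v hv w hw a ha b hb, key w hw v hv a ha b hb⟩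

end Election

theorem hiddenID_iff (I : HiddenIDInstance) : HiddenID I ↔
    I.m' ≤ I.numCandidates ∧ I.n' ≤ I.numVoters ∧ ∃ y ∈ selections I.numVoters I.n' [],
      levelsNonempty y (ballotWords I.election) (candidateWords I.numCandidates) I.m'
        (candidateWords I.numCandidates) = true := by
  rw [Election.exists_mem_selections_iff]
  have hlev : ∀ V', levelsNonempty (Election.selectionBits V') (ballotWords I.election)
      (candidateWords I.numCandidates) I.m' (candidateWords I.numCandidates) = true ↔
      ∃ l : List (Fin I.numCandidates), l.length = I.m' ∧ l.IsChain (I.election.Dominates V') := by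
    intro V'
    refine (I.election.levelsNonempty_iff V' I.m' (List.finRange _)).trans ?_
    simp
  simp only [hlev]
  constructor
  · rintro ⟨C', V', hC, hV, h⟩
    -- The search visits only sets of exactly `n'` voters, so superfluous voters are discarded.
    obtain ⟨V'', hsub, hcard⟩ := Finset.exists_subset_card_eq hV
    have hCle := Finset.card_le_univ C'
    have hVle := Finset.card_le_univ V'
    rw [Fintype.card_fin] at hCle hVle
    refine ⟨hC.trans hCle, hV.trans hVle, V'', hcard,
      I.election.exists_chain_of_isIdentity C' V'' ?_ I.m' hC⟩
    intro v w
    exact h ⟨v, hsub v.2⟩ ⟨w, hsub w.2⟩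
  · rintro ⟨hm, -, V', hV, l, hl, hc⟩
    obtain ⟨C', hC, h⟩ := I.election.exists_isIdentity_of_chain V' l hc (hl ▸ hm)
    exact ⟨C', V', hl ▸ hC, hV.ge, h⟩

/-! ### Running times -/

theorem DecidableInTime.mono {α Γ : Type} {enc : α → List Γ} {Q : α → Prop} {T T' : α → ℕ}
    (h : DecidableInTime enc Q T) (hT : ∀ x, T x ≤ T' x) : DecidableInTime enc Q T' := by
  obtain ⟨M, hM⟩ := h
  refine ⟨M, fun x => ?_⟩
  obtain ⟨⟨e, he⟩⟩ := hM x
  exact ⟨⟨e, he.trans (hT x)⟩⟩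

theorem hiddenID_decidableInTime : DecidableInTime encodeInstance HiddenID fun I =>
    (I.numVoters.choose I.n' + 1) * StackProg.mainTime (encodeInstance I).length := by
  refine StackProg.decidableInTime_of_run StackProg.mainProg Stk.inp Stk.ans fun I => ?_
  have h := StackProg.mainProg_takes (N := (encodeInstance I).length)
    (Computability.encodeNat I.m') (Computability.encodeNat I.n')
    (candidateWords I.numCandidates) (ballotWords I.election) (by rw [← encodeInstance_eq])
  have h₁ : (candidateWords I.numCandidates).length = I.numCandidates := by simp [candidateWords]
  have h₂ : (ballotWords I.election).length = I.numVoters := by simp [ballotWords]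
  rw [← encodeInstance_eq, wordValue_encodeNat, wordValue_encodeNat, h₁, h₂] at h
  refine h.to ?_ le_rfl
  congr
  exact propext (hiddenID_iff I).symm

/-- The time bounds are defined over any commutative semiring, so the same expression is a number
for the run and a polynomial for the complexity class. -/
theorem eval_mainTime (N : ℕ) :
    (StackProg.mainTime (Polynomial.X : Polynomial ℕ)).eval N = StackProg.mainTime N := by
  simp [StackProg.mainTime, StackProg.visitTime, StackProg.checkTime, StackProg.stepTime,
    StackProg.outerTime, StackProg.testTime, StackProg.setupTime]

/-- With `2 ≤ N`, a coefficient satisfies `c ≤ 2 ^ c ≤ N ^ c`, and the factor `2` from adding two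
powers is absorbed by one more `N`. -/
theorem exists_eval_le_pow (p : Polynomial ℕ) : ∃ d, ∀ N, 2 ≤ N → p.eval N ≤ N ^ d := by
  induction p using Polynomial.induction_on' with
  | add p q hp hq =>
    obtain ⟨a, ha⟩ := hp
    obtain ⟨b, hb⟩ := hq
    refine ⟨max a b + 1, fun N hN => ?_⟩
    have h₁ : N ^ a ≤ N ^ max a b := Nat.pow_le_pow_right (by omega) (le_max_left a b)
    have h₂ : N ^ b ≤ N ^ max a b := Nat.pow_le_pow_right (by omega) (le_max_right a b)
    calc (p + q).eval N = p.eval N + q.eval N := Polynomial.eval_add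
      _ ≤ N ^ max a b * 2 := by have := ha N hN; have := hb N hN; omega
      _ ≤ N ^ max a b * N := Nat.mul_le_mul_left _ hN
  | monomial n c =>
    refine ⟨c + n, fun N hN => ?_⟩
    rw [Polynomial.eval_monomial, pow_add]
    exact Nat.mul_le_mul_right _ (c.lt_two_pow_self.le.trans (Nat.pow_le_pow_left hN c))

theorem numVoters_lt_length (I : HiddenIDInstance) : I.numVoters + 2 ≤ (encodeInstance I).length := by
  have h := length_le_length_encodeTable (ballotWords I.election)
  have h₂ : (ballotWords I.election).length = I.numVoters := by simp [ballotWords]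
  rw [encodeInstance_eq]
  simp
  omega

/-- Hidden-ID is fixed-parameter tractable for the number of voters of the election, and in XP for
the number `n'` of voters in the solution. -/
theorem mainTheorem6 :
    InFPT encodeInstance HiddenID (fun I => I.numVoters) ∧
      InXP encodeInstance HiddenID (fun I => I.n') := by
  constructor
  · refine ⟨fun k => 2 ^ k + 1, StackProg.mainTime Polynomial.X, ?_,
      hiddenID_decidableInTime.mono fun I => ?_⟩
    · have h := Primrec₂.unpaired'.1 Nat.Primrec.pow
      exact (Primrec.nat_add.comp (h.comp (Primrec.const 2) Primrec.id) (Primrec.const 1)).to_comp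
    · rw [eval_mainTime]
      exact Nat.mul_le_mul_right _ (Nat.succ_le_succ (Nat.choose_le_two_pow _ _))
  · obtain ⟨d, hd⟩ := exists_eval_le_pow (StackProg.mainTime Polynomial.X)
    -- The exponent `k` pays for the selections, `1` for the summand in `choose + 1`, and `d` for
    -- the polynomial factor.
    refine ⟨fun k => k + (1 + d), ?_, hiddenID_decidableInTime.mono fun I => ?_⟩
    · exact (Primrec.nat_add.comp Primrec.id (Primrec.const (1 + d))).to_comp
    · have hN := numVoters_lt_length I
      have h₁ := hd (encodeInstance I).length (by omega)
      rw [eval_mainTime] at h₁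
      generalize (encodeInstance I).length = N at *
      have h₂ : I.numVoters.choose I.n' ≤ N ^ I.n' :=
        (Nat.choose_le_pow _ _).trans (Nat.pow_le_pow_left (by omega) _)
      have h₃ : 1 ≤ N ^ I.n' := Nat.one_le_pow _ _ (by omega)
      have h₄ : I.numVoters.choose I.n' + 1 ≤ N ^ I.n' * N := by nlinarith
      calc (I.numVoters.choose I.n' + 1) * StackProg.mainTime N
          ≤ N ^ I.n' * N * N ^ d := Nat.mul_le_mul h₄ h₁
        _ = N ^ (I.n' + (1 + d)) := by ring
        _ ≤ _ := Nat.le_add_right _ _
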